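/- **Setting.** Fix $s>1$. For $h>0$ let $x_j=jh$ ($j\in\mathbb Z$). The $P_1$ SIPG semi-discretization of $\partial_t^2u=\partial_x^2u$ on $\mathbb R$ with penalty $s$, written for the averages and jumps $U(t)=(A_j(t),J_j(t))_{j\in\mathbb Z}\in\ell^2(\mathbb Z;\mathbb C^2)$, is $M_hU''+R_h^sU=0$, where $M_h,R_h^s$ are the block tri-diagonal matrices that repeat the stencils $$\left(\begin{array}{cc|cc|cc}\frac h6&-\frac h{12}&\frac{2h}3&0&\frac h6&\frac h{12}\\ \frac h{12}&-\frac h{24}&0&\frac h6&-\frac h{12}&-\frac h{24}\end{array}\right),\qquad \left(\begin{array}{cc|cc|cc}-\frac1h&0&\frac2h&0&-\frac1h&0\\0&-\frac1{4h}&0&\frac{2s-1}{2h}&0&-\frac1{4h}\end{array}\right).$$ For $\xi\in\Pi_h=[-\pi/h,\pi/h]$ let $S_h^s(\xi)=M_h(\xi)^{-1}R_h^s(\xi)$ with the symbols $$M_h(\xi)=\begin{pmatrix}\frac{2+\cos\xi h}3&\frac{i\sin\xi h}6\\-\frac{i\sin\xi h}6&\frac{2-\cos\xi h}{12}\end{pmatrix},\qquad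 R_h^s(\xi)=\begin{pmatrix}\frac4{h^2}\sin^2\frac{\xi h}2&0\\0&\frac{s-\cos^2(\xi h/2)}{h^2}\end{pmatrix}.$$ Its eigenvalues are real and nonnegative; $\Lambda^s_{ph,h}(\xi)$ (physical) is the smaller and $\Lambda^s_{sp,h}(\xi)$ (spurious) the larger one, and $\lambda^s_{m,h}=\sqrt{\Lambda^s_{m,h}}$ for $m\in\{ph,sp\}$. Since $S_h^s(\xi)=h^{-2}S_1^s(h\xi)$, corresponding eigenvectors are $P^s_{m,h}(\xi)=P(h\xi)$, where $P$ is any smooth, bounded, nowhere vanishing field of eigenvectors of $S_1^s(\eta)$, $\eta\in(-\pi,\pi)$, for $\Lambda^s_{m,1}(\eta)$. The total energy of $(U,V)$, $V=U'$, is $E_h^s=\frac12(\langle R_h^sU,U\rangle+\langle M_hV,V\rangle)$. With $\Omega=\mathbb R\setminus(-1,1)$, the energy $E_{\Omega,h}^s$ in $\Omega$ is defined in the same way with $\langle\cdot,\cdot\rangle$ replaced by the inner product of $\ell^2(\{j:x_j\in\Omega\})$, either (a) by restricting only the outer product, $\langle RU,U\rangle_\Omega=\mathrm{Re}\sum_{x_j\in\Omega}(RU)_j\cdot\overline{U_j}$,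 or (b) by restricting $U$, $V$ and the matrices to the nodes of $\Omega$. The results below hold for both. $C_h^s(T)\in[0,\infty]$ denotes the infimum of all $C\ge0$ such that $E_h^s(U(0),U'(0))\le C\int_0^TE_{\Omega,h}^s(U(t),U'(t))\,dt$ for all $\ell^2$-valued solutions ($\infty$ if there is no such $C$). **Proposition.** Let $s>1$, $T>0$, $m\in\{ph,sp\}$, $x^*\in\mathbb R$, and $\eta_0\in(-\pi,\pi)$, with $\eta_0\ne0$ if $m=ph$. Suppose that the ray $x_m(t)=x^*-t\,\partial_\xi\lambda^s_{m,1}(\eta_0)$ stays outside $\Omega$ for all $t\in[0,T]$. Let $P$ be an eigenvector field for the mode $m$ as above, and let $0\ne\varphi\in\mathcal S(\mathbb R)$ with $\widehat\varphi(\xi)=\int_{\mathbb R}\varphi(x)e^{-i\xi x}\,dx$. For $h,\gamma>0$ put $\xi_0=\eta_0/h$, and for $\xi\in\Pi_h$ let $$\widehat u^{h,0}(\xi)=\sqrt{\tfrac{2\pi}\gamma}\;\widehat\varphi\Big(\frac{\xi-\xi_0}\gamma\Big)e^{-ix^*(\xi-\xi_0)},\qquad \widehat u^{h,1}(\xi)=i\lambda^s_{m,h}(\xi)\,\widehat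 u^{h,0}(\xi),$$ $$U^{h,i}_j=\frac1{2\pi}\int_{-\pi/h}^{\pi/h}P(h\xi)\,\widehat u^{h,i}(\xi)\,e^{i\xi x_j}\,d\xi\qquad(j\in\mathbb Z,\ i=0,1).$$ Then there is $\varepsilon>0$ such that for every $\alpha\ge0$ there is $C_\alpha>0$, independent of $h$ and $\gamma$, with the following property. Whenever $h>0$, $\gamma\ge1/\varepsilon$ and $h\gamma\le\varepsilon$ (that is, $\gamma\gg1$ and $h\gamma\ll1$): 1. $C_h^s(T)\ge C_\alpha\,\gamma^\alpha$; 2. there is an $\ell^2$-valued solution $U$ with $U(0)=U^{h,0}$ and $U'(0)=U^{h,1}$, it has positive energy, and $$E_h^s(U^{h,0},U^{h,1})\ \ge\ C_\alpha\,\min\Big\{\gamma,\frac1{h\gamma}\Big\}^{\alpha}\int_0^T\big|E_{\Omega,h}^s(U(t),U'(t))\big|\,dt .$$ In particular, if $h\gamma\le\gamma^{-\delta}$ for some $\delta>0$ (for instance $\gamma=h^{-\theta}$ with $0<\theta<1$), the wave packets themselves violate uniform observability faster than any power of $\gamma$. -/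

import Mathlib

open scoped Matrix

noncomputable section

namespace SIPG

/-! ### The grid, the mass and stiffness operators -/

/-- Sequences `(A_j, J_j)_{j ∈ ℤ}` of averages (component `0`) and jumps (component `1`). -/
abbrev GridFun : Type := ℤ → Fin 2 → ℂ

/-- Square-summable sequences of averages and jumps. -/
abbrev GridState : Type := lp (fun _ : ℤ => EuclideanSpace ℂ (Fin 2)) 2

/-- The underlying sequence of an element of `ℓ²`. -/
def coords (U : GridState) : GridFun := fun j c => U j c

/-- The node `x_j = j h` of the uniform grid. -/
def node (h : ℝ) (j : ℤ) : ℝ := (j : ℝ) * h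

/-- The operator given by the infinite repetition of the stencil `(L | D | R)`. -/
def stencilOp (L D R : Matrix (Fin 2) (Fin 2) ℂ) (u : GridFun) : GridFun := fun j =>
  L *ᵥ u (j - 1) + D *ᵥ u j + R *ᵥ u (j + 1)

/-- The mass matrix of the `P₁` SIPG method, acting on sequences. -/
def massOp (h : ℝ) : GridFun → GridFun :=
  stencilOp
    !![(h : ℂ) / 6, -(h : ℂ) / 12; (h : ℂ) / 12, -(h : ℂ) / 24]
    !![2 * (h : ℂ) / 3, 0; 0, (h : ℂ) / 6]
    !![(h : ℂ) / 6, (h : ℂ) / 12; -(h : ℂ) / 12, -(h : ℂ) / 24]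

/-- The stiffness matrix of the `P₁` SIPG method with penalty `s`, acting on sequences. -/
def stiffOp (h s : ℝ) : GridFun → GridFun :=
  stencilOp
    !![-1 / (h : ℂ), 0; 0, -1 / (4 * (h : ℂ))]
    !![2 / (h : ℂ), 0; 0, (2 * (s : ℂ) - 1) / (2 * (h : ℂ))]
    !![-1 / (h : ℂ), 0; 0, -1 / (4 * (h : ℂ))]

/-- `U` is an `ℓ²`-valued solution of `M_h U'' + R_h^s U = 0`, and `V = U'`. -/
def IsSolution (h s : ℝ) (U V : ℝ → GridState) : Prop :=
  ∃ W : ℝ → GridState, ∀ t : ℝ, HasDerivAt U (V t) t ∧ HasDerivAt V (W t) t ∧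
    massOp h (coords (W t)) + stiffOp h s (coords (U t)) = 0

/-! ### Energies and the observability constant -/

/-- The (real part of the) inner product of `ℓ²(S)`. -/
def pairing (S : Set ℤ) (f g : GridFun) : ℝ :=
  ∑' j : S, (star (g j) ⬝ᵥ f j).re

/-- `(⟨R U, U⟩_S + ⟨M V, V⟩_S) / 2`. -/
def energyOn (S : Set ℤ) (h s : ℝ) (U V : GridFun) : ℝ :=
  (pairing S (stiffOp h s U) U + pairing S (massOp h V) V) / 2

/-- The total discrete energy. -/
def totalEnergy (h s : ℝ) (U V : GridFun) : ℝ := energyOn Set.univ h s U V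

/-- The observation region `ℝ ∖ (-1, 1)`. -/
def obsRegion : Set ℝ := (Set.Ioo (-1) 1)ᶜ

/-- The indices of the nodes lying in the observation region. -/
def obsIndices (h : ℝ) : Set ℤ := {j | node h j ∈ obsRegion}

/-- The two ways of replacing the `ℓ²` inner product in the energy by the one of `ℓ²(S)`,
where `S` is the set of the observed nodes. -/
inductive Localization
  /-- `⟨R U, U⟩_S + ⟨M V, V⟩_S`: only the outer pairing is restricted to `S`. -/
  | pairing
  /-- `⟨R_S U_S, U_S⟩ + ⟨M_S V_S, V_S⟩`: vectors and matrices are restricted to `S`. -/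
  | truncation

/-- The discrete energy concentrated in the observation region. -/
def obsEnergy : Localization → ℝ → ℝ → GridFun → GridFun → ℝ
  | .pairing, h, s, U, V => energyOn (obsIndices h) h s U V
  | .truncation, h, s, U, V =>
      totalEnergy h s ((obsIndices h).indicator U) ((obsIndices h).indicator V)

/-- `C` is admissible in the observability inequality in time `T`. -/
def IsObservabilityBound (loc : Localization) (h s T C : ℝ) : Prop :=
  0 ≤ C ∧ ∀ U V : ℝ → GridState, IsSolution h s U V →
    totalEnergy h s (coords (U 0)) (coords (V 0)) ≤
      C * ∫ t in (0 : ℝ)..T, obsEnergy loc h s (coords (U t)) (coords (V t))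

/-- The observability constant: the best constant in the observability inequality
(`∞` if there is none). -/
def obsConstant (loc : Localization) (h s T : ℝ) : ENNReal :=
  sInf (ENNReal.ofReal '' {C : ℝ | IsObservabilityBound loc h s T C})

/-! ### Fourier symbols and dispersion relations -/

/-- The Fourier symbol of the mass matrix. -/
def massSymbol (h ξ : ℝ) : Matrix (Fin 2) (Fin 2) ℂ :=
  !![((2 + Real.cos (ξ * h)) / 3 : ℝ), Complex.I * (Real.sin (ξ * h) / 6 : ℝ);
     -Complex.I * (Real.sin (ξ * h) / 6 : ℝ), ((2 - Real.cos (ξ * h)) / 12 : ℝ)]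

/-- The Fourier symbol of the stiffness matrix. -/
def stiffSymbol (h s ξ : ℝ) : Matrix (Fin 2) (Fin 2) ℂ :=
  !![(4 / h ^ 2 * Real.sin (ξ * h / 2) ^ 2 : ℝ), 0;
     0, ((s - Real.cos (ξ * h / 2) ^ 2) / h ^ 2 : ℝ)]

/-- `S_h^s(ξ) = M_h(ξ)⁻¹ R_h^s(ξ)`. -/
def symbol (h s ξ : ℝ) : Matrix (Fin 2) (Fin 2) ℂ := (massSymbol h ξ)⁻¹ * stiffSymbol h s ξ

/-- The (real) eigenvalues of `S_h^s(ξ)`. -/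
def eigenvalues (h s ξ : ℝ) : Set ℝ :=
  {Λ | ∃ v : Fin 2 → ℂ, v ≠ 0 ∧ symbol h s ξ *ᵥ v = (Λ : ℂ) • v}

/-- The two components of the numerical solutions. -/
inductive Mode
  | physical
  | spurious

/-- The physical eigenvalue is the lower one, the spurious eigenvalue the upper one. -/
def eigenvalue : Mode → ℝ → ℝ → ℝ → ℝ
  | .physical, h, s, ξ => sInf (eigenvalues h s ξ)
  | .spurious, h, s, ξ => sSup (eigenvalues h s ξ)

/-- The dispersion relation `λ_{mode,h}^s(ξ)`. -/
def dispersion (m : Mode) (h s ξ : ℝ) : ℝ := Real.sqrt (eigenvalue m h s ξ)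

/-- `P` is a choice of eigenvectors of `S_1^s(η)` for the given mode, smooth and bounded on
`(-π, π)`; the eigenvector of `S_h^s(ξ)` is then `P (h ξ)`, since `S_h^s(ξ) = h⁻² S_1^s(h ξ)`. -/
structure IsEigenvectorField (m : Mode) (s : ℝ) (P : ℝ → Fin 2 → ℂ) : Prop where
  smooth : ContDiffOn ℝ (⊤ : ℕ∞) P (Set.Ioo (-Real.pi) Real.pi)
  bounded : ∃ K : ℝ, ∀ η ∈ Set.Ioo (-Real.pi) Real.pi, ‖P η‖ ≤ K
  ne_zero : ∀ η ∈ Set.Ioo (-Real.pi) Real.pi, P η ≠ 0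
  eigen : ∀ η ∈ Set.Ioo (-Real.pi) Real.pi,
    symbol 1 s η *ᵥ P η = (eigenvalue m 1 s η : ℂ) • P η

/-! ### Wave packets -/

/-- The Fourier transform with the convention `∫ φ(x) exp(-i x ξ) dx`. -/
def fourierTransform (φ : SchwartzMap ℝ ℂ) (ξ : ℝ) : ℂ :=
  ∫ x : ℝ, Complex.exp (-Complex.I * (x * ξ : ℝ)) * φ x

/-- The inverse semi-discrete Fourier transform of a function on `[-π/h, π/h]`. -/
def inverseSDFT (h : ℝ) (F : ℝ → Fin 2 → ℂ) : GridFun := fun j c =>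
  (1 / (2 * Real.pi : ℝ) : ℂ) *
    ∫ ξ in (-Real.pi / h)..(Real.pi / h), F ξ c * Complex.exp (Complex.I * (ξ * node h j : ℝ))

/-- The scalar profile of the wave packet at scale `γ`, centred at the position `xs` and at the
wave number `ξ₀ = η₀ / h` (considered on `[-π/h, π/h]` only). -/
def profile (φ : SchwartzMap ℝ ℂ) (xs η₀ h γ ξ : ℝ) : ℂ :=
  (Real.sqrt (2 * Real.pi / γ) : ℂ) * fourierTransform φ ((ξ - η₀ / h) / γ) *
    Complex.exp (-Complex.I * (xs * (ξ - η₀ / h) : ℝ))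

/-- The initial position of the wave packet. -/
def packetPosition (P : ℝ → Fin 2 → ℂ) (φ : SchwartzMap ℝ ℂ) (xs η₀ h γ : ℝ) : GridFun :=
  inverseSDFT h fun ξ => profile φ xs η₀ h γ ξ • P (h * ξ)

/-- The initial velocity of the wave packet. -/
def packetVelocity (m : Mode) (s : ℝ) (P : ℝ → Fin 2 → ℂ) (φ : SchwartzMap ℝ ℂ)
    (xs η₀ h γ : ℝ) : GridFun :=
  inverseSDFT h fun ξ =>
    (Complex.I * (dispersion m h s ξ : ℂ) * profile φ xs η₀ h γ ξ) • P (h * ξ)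

end SIPG

end

noncomputable section

namespace SIPG

/-! The proof tests the inequality on Gaussian-beam-like wave packets of one mode. After the
semi-discrete Fourier transform and the substitution η = hξ, an eigenvector field turns the system
into scalar oscillators of frequency λ(η)/h, so a packet with profile Φ centred at η₀ evolves
explicitly (`exists_isSolution`). With η = η₀ + hγζ its value at x_j is, up to a factor of modulus
one, √(γ/2π) times an integral of Φ(ζ) times the eigenvector against an oscillating exponential with
phase γ((x_j - x*)ζ + t(λ(η₀ + hγζ) - λ(η₀))/(hγ)) (`norm_sdft_packet`).

The ζ-derivative of this phase is γ(x_j - x* + tλ'(η)). For η close to η₀ it is comparable to γ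
times the distance from x_j to the ray. The ray, followed over a compact time interval, keeps a
positive distance 3d from the observed region, so the phase is non-stationary there, and n
integrations by parts gain (γ·distance)^(-n) (`SymbolBound.nonstationary`, `exists_packet_decay`).
Squaring and summing over the grid gives O(γ^(1-2n)/h). The frequencies at a fixed distance from η₀,
where λ may fail to be smooth and λ' is not controlled, are cut off; Parseval bounds them by the
tail of |Φ|² beyond a multiple of 1/(hγ). Together this is `exists_localization`, and the observed
energy is at most h^(-2) times these two small quantities.

The total energy is at least a constant times h^(-2). The stiffness form dominates (s-1)/h times the
ℓ²-norm squared of the jumps (`le_totalEnergy`), and the jump component of an eigenvector cannot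
vanish at η₀ (`IsEigenvectorField.jump_ne_zero`), so Parseval bounds the jumps from below
(`le_tsum_jump`). Both bounds are collected in `exists_packet_energy_bounds`.

For the given φ, the tail of its transform decays like any power of hγ, which produces min(γ,
1/(hγ)). The bound on the observability constant is free to use another packet: a profile with
compactly supported Fourier transform has no tail once hγ is small, and only powers of γ remain. -/

/-! ### Energy estimates on the grid -/

/-- The real part of `conj a * b`. -/
def reDot (a b : ℂ) : ℝ := a.re * b.re + a.im * b.im

theorem re_star_dot_stiffOp (h s : ℝ) (u : GridFun) (j : ℤ) :
    (star (u j) ⬝ᵥ stiffOp h s u j).re =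
      h⁻¹ * (2 * reDot (u j 0) (u j 0) - reDot (u j 0) (u (j - 1) 0) - reDot (u j 0) (u (j + 1) 0)
        + (s - 1 / 2) * reDot (u j 1) (u j 1)
        - (reDot (u j 1) (u (j - 1) 1) + reDot (u j 1) (u (j + 1) 1)) / 4) := by
  have e1 : -1 / (h : ℂ) = ((-h⁻¹ : ℝ) : ℂ) := by push_cast; ring
  have e2 : 2 / (h : ℂ) = ((2 * h⁻¹ : ℝ) : ℂ) := by push_cast; ring
  have e3 : -1 / (4 * (h : ℂ)) = ((-h⁻¹ / 4 : ℝ) : ℂ) := by push_cast; ring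
  have e4 : (2 * (s : ℂ) - 1) / (2 * (h : ℂ)) = ((h⁻¹ * (s - 1 / 2) : ℝ) : ℂ) := by
    push_cast; ring
  simp only [stiffOp, stencilOp, e1, e2, e3, e4, dotProduct, Matrix.mulVec, Fin.sum_univ_two,
    Pi.add_apply, Pi.star_apply, Matrix.of_apply, Matrix.cons_val_zero, Matrix.cons_val_one,
    RCLike.star_def, Complex.add_re, Complex.add_im, Complex.mul_re, Complex.mul_im,
    Complex.conj_re, Complex.conj_im, Complex.ofReal_re, Complex.ofReal_im, zero_mul,
    Complex.zero_re, Complex.zero_im, reDot, Matrix.cons_val', Matrix.cons_val_fin_one]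
  ring

theorem re_star_dot_massOp (h : ℝ) (u : GridFun) (j : ℤ) :
    (star (u j) ⬝ᵥ massOp h u j).re =
      h * (2 / 3 * reDot (u j 0) (u j 0)
        + (reDot (u j 0) (u (j - 1) 0) + reDot (u j 0) (u (j + 1) 0)) / 6
        + (reDot (u j 0) (u (j + 1) 1) - reDot (u j 0) (u (j - 1) 1)) / 12
        + (reDot (u j 1) (u (j - 1) 0) - reDot (u j 1) (u (j + 1) 0)) / 12
        + reDot (u j 1) (u j 1) / 6
        - (reDot (u j 1) (u (j - 1) 1) + reDot (u j 1) (u (j + 1) 1)) / 24) := by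
  have e1 : (h : ℂ) / 6 = ((h / 6 : ℝ) : ℂ) := by push_cast; ring
  have e2 : -(h : ℂ) / 12 = ((-h / 12 : ℝ) : ℂ) := by push_cast; ring
  have e3 : (h : ℂ) / 12 = ((h / 12 : ℝ) : ℂ) := by push_cast; ring
  have e4 : -(h : ℂ) / 24 = ((-h / 24 : ℝ) : ℂ) := by push_cast; ring
  have e5 : 2 * (h : ℂ) / 3 = ((2 * h / 3 : ℝ) : ℂ) := by push_cast; ring
  simp only [massOp, stencilOp, e1, e2, e3, e4, e5, dotProduct, Matrix.mulVec, Fin.sum_univ_two,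
    Pi.add_apply, Pi.star_apply, Matrix.of_apply, Matrix.cons_val_zero, Matrix.cons_val_one,
    RCLike.star_def, Complex.add_re, Complex.add_im, Complex.mul_re, Complex.mul_im,
    Complex.conj_re, Complex.conj_im, Complex.ofReal_re, Complex.ofReal_im, zero_mul,
    Complex.zero_re, Complex.zero_im, reDot, Matrix.cons_val', Matrix.cons_val_fin_one]
  ring

theorem reDot_self (a : ℂ) : reDot a a = ‖a‖ ^ 2 := by
  rw [Complex.sq_norm, Complex.normSq_apply]; rfl

theorem abs_reDot_le (a b : ℂ) : |reDot a b| ≤ (‖a‖ ^ 2 + ‖b‖ ^ 2) / 2 := by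
  simp only [Complex.sq_norm, Complex.normSq_apply, reDot, abs_le]
  constructor <;> nlinarith [sq_nonneg (a.re - b.re), sq_nonneg (a.im - b.im),
    sq_nonneg (a.re + b.re), sq_nonneg (a.im + b.im)]

/-- Young's inequality with the weights suited to an average `a` and a jump `b`. With these weights
the lower bound of the mass form consists of second differences only. -/
theorem abs_reDot_le' (a b : ℂ) : |reDot a b| ≤ ‖a‖ ^ 2 + ‖b‖ ^ 2 / 4 := by
  simp only [Complex.sq_norm, Complex.normSq_apply, reDot, abs_le]
  constructor <;> nlinarith [sq_nonneg (2 * a.re - b.re), sq_nonneg (2 * a.im - b.im),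
    sq_nonneg (2 * a.re + b.re), sq_nonneg (2 * a.im + b.im)]

theorem reDot_comm (a b : ℂ) : reDot a b = reDot b a := by
  simp only [reDot]; ring

/-- The squared Euclidean norm of the value at a node. -/
def sqNorm (u : GridFun) (j : ℤ) : ℝ := ‖u j 0‖ ^ 2 + ‖u j 1‖ ^ 2

theorem sqNorm_nonneg (u : GridFun) (j : ℤ) : 0 ≤ sqNorm u j := by
  unfold sqNorm; positivity

/-- Young's inequality on the neighbour products. Apart from the term with s - 1, the lower bound is
a combination of second differences, which sum to zero over ℤ. -/
theorem le_re_star_dot_stiffOp {h : ℝ} (hh : 0 < h) (s : ℝ) (u : GridFun) (j : ℤ) :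
    h⁻¹ * ((‖u j 0‖ ^ 2 - (‖u (j - 1) 0‖ ^ 2 + ‖u (j + 1) 0‖ ^ 2) / 2)
      + ((s - 1) * ‖u j 1‖ ^ 2
        + (2 * ‖u j 1‖ ^ 2 - ‖u (j - 1) 1‖ ^ 2 - ‖u (j + 1) 1‖ ^ 2) / 8))
      ≤ (star (u j) ⬝ᵥ stiffOp h s u j).re := by
  rw [re_star_dot_stiffOp]
  refine mul_le_mul_of_nonneg_left ?_ (by positivity)
  simp only [reDot_self]
  have h1 := abs_le.1 (abs_reDot_le (u j 0) (u (j - 1) 0))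
  have h2 := abs_le.1 (abs_reDot_le (u j 0) (u (j + 1) 0))
  have h3 := abs_le.1 (abs_reDot_le (u j 1) (u (j - 1) 1))
  have h4 := abs_le.1 (abs_reDot_le (u j 1) (u (j + 1) 1))
  linarith [h1.2, h2.2, h3.2, h4.2]

/-- The mixed products take the weighted Young inequality, the others the symmetric one. What is
left is a combination of second differences, so that summation yields nonnegativity of the mass
form, which is all that is needed of it. -/
theorem le_re_star_dot_massOp {h : ℝ} (hh : 0 < h) (u : GridFun) (j : ℤ) :
    h * ((2 * ‖u j 0‖ ^ 2 - ‖u (j - 1) 0‖ ^ 2 - ‖u (j + 1) 0‖ ^ 2) / 6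
        + (2 * ‖u j 1‖ ^ 2 - ‖u (j - 1) 1‖ ^ 2 - ‖u (j + 1) 1‖ ^ 2) / 24)
      ≤ (star (u j) ⬝ᵥ massOp h u j).re := by
  rw [re_star_dot_massOp]
  refine mul_le_mul_of_nonneg_left ?_ hh.le
  simp only [reDot_self]
  have h1 := abs_le.1 (abs_reDot_le (u j 0) (u (j - 1) 0))
  have h2 := abs_le.1 (abs_reDot_le (u j 0) (u (j + 1) 0))
  have h3 := abs_le.1 (abs_reDot_le (u j 1) (u (j - 1) 1))
  have h4 := abs_le.1 (abs_reDot_le (u j 1) (u (j + 1) 1))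
  have h5 := abs_le.1 (abs_reDot_le' (u j 0) (u (j - 1) 1))
  have h6 := abs_le.1 (abs_reDot_le' (u j 0) (u (j + 1) 1))
  have h7 := abs_le.1 (abs_reDot_le' (u (j - 1) 0) (u j 1))
  have h8 := abs_le.1 (abs_reDot_le' (u (j + 1) 0) (u j 1))
  rw [reDot_comm] at h7 h8
  linarith [h1.1, h2.1, h3.2, h4.2, h5.2, h6.1, h7.1, h8.2]

theorem abs_re_star_dot_stiffOp_le {h s : ℝ} (hh : 0 < h) (hs : 1 < s) (u : GridFun) (j : ℤ) :
    |(star (u j) ⬝ᵥ stiffOp h s u j).re| ≤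
      (s + 4) * h⁻¹ * (sqNorm u (j - 1) + sqNorm u j + sqNorm u (j + 1)) := by
  have hp : 0 ≤ h⁻¹ := by positivity
  rw [re_star_dot_stiffOp, abs_mul, abs_of_nonneg hp, mul_comm (s + 4), mul_assoc]
  refine mul_le_mul_of_nonneg_left ?_ hp
  simp only [reDot_self, sqNorm]
  have h1 := abs_le.1 (abs_reDot_le (u j 0) (u (j - 1) 0))
  have h2 := abs_le.1 (abs_reDot_le (u j 0) (u (j + 1) 0))
  have h3 := abs_le.1 (abs_reDot_le (u j 1) (u (j - 1) 1))
  have h4 := abs_le.1 (abs_reDot_le (u j 1) (u (j + 1) 1))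
  have g1 := sq_nonneg ‖u j 0‖
  have g2 := sq_nonneg ‖u (j - 1) 0‖
  have g3 := sq_nonneg ‖u (j + 1) 0‖
  have g4 := sq_nonneg ‖u j 1‖
  have g5 := sq_nonneg ‖u (j - 1) 1‖
  have g6 := sq_nonneg ‖u (j + 1) 1‖
  have k : ∀ x : ℝ, 0 ≤ x → x ≤ s * x := fun x hx => by nlinarith
  have k1 := k _ g1
  have k2 := k _ g2
  have k3 := k _ g3
  have k4 := k _ g4
  have k5 := k _ g5
  have k6 := k _ g6
  rw [abs_le]
  constructor <;> linarith [h1.1, h2.1, h3.1, h4.1, h1.2, h2.2, h3.2, h4.2]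

theorem abs_re_star_dot_massOp_le {h : ℝ} (hh : 0 < h) (u : GridFun) (j : ℤ) :
    |(star (u j) ⬝ᵥ massOp h u j).re| ≤
      2 * h * (sqNorm u (j - 1) + sqNorm u j + sqNorm u (j + 1)) := by
  rw [re_star_dot_massOp, abs_mul, abs_of_nonneg hh.le, mul_comm 2, mul_assoc]
  refine mul_le_mul_of_nonneg_left ?_ hh.le
  simp only [reDot_self, sqNorm]
  have h1 := abs_le.1 (abs_reDot_le (u j 0) (u (j - 1) 0))
  have h2 := abs_le.1 (abs_reDot_le (u j 0) (u (j + 1) 0))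
  have h3 := abs_le.1 (abs_reDot_le (u j 1) (u (j - 1) 1))
  have h4 := abs_le.1 (abs_reDot_le (u j 1) (u (j + 1) 1))
  have h5 := abs_le.1 (abs_reDot_le (u j 0) (u (j - 1) 1))
  have h6 := abs_le.1 (abs_reDot_le (u j 0) (u (j + 1) 1))
  have h7 := abs_le.1 (abs_reDot_le (u j 1) (u (j - 1) 0))
  have h8 := abs_le.1 (abs_reDot_le (u j 1) (u (j + 1) 0))
  have g1 := sq_nonneg ‖u j 0‖
  have g2 := sq_nonneg ‖u (j - 1) 0‖
  have g3 := sq_nonneg ‖u (j + 1) 0‖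
  have g4 := sq_nonneg ‖u j 1‖
  have g5 := sq_nonneg ‖u (j - 1) 1‖
  have g6 := sq_nonneg ‖u (j + 1) 1‖
  rw [abs_le]
  constructor <;> linarith [h1.1, h2.1, h3.1, h4.1, h1.2, h2.2, h3.2, h4.2, h5.1, h6.1, h7.1,
    h8.1, h5.2, h6.2, h7.2, h8.2]

theorem hasSum_shift {f : ℤ → ℝ} {a : ℝ} (hf : HasSum f a) (k : ℤ) :
    HasSum (fun j => f (j + k)) a :=
  (Equiv.addRight k).hasSum_iff.2 hf

theorem hasSum_sub_one {f : ℤ → ℝ} {a : ℝ} (hf : HasSum f a) :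
    HasSum (fun j => f (j - 1)) a := hasSum_shift hf (-1)

theorem summable_neighbours {u : GridFun} (hu : Summable (sqNorm u)) :
    Summable fun j => sqNorm u (j - 1) + sqNorm u j + sqNorm u (j + 1) :=
  ((hasSum_sub_one hu.hasSum).summable.add hu).add (hasSum_shift hu.hasSum 1).summable

theorem summable_component {u : GridFun} (hu : Summable (sqNorm u)) (c : Fin 2) :
    Summable fun j => ‖u j c‖ ^ 2 := by
  refine Summable.of_nonneg_of_le (fun j => by positivity) (fun j => ?_) hu
  have h0 := sq_nonneg ‖u j 0‖
  have h1 := sq_nonneg ‖u j 1‖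
  fin_cases c <;> simp only [sqNorm] <;> simp

theorem pairing_univ (f g : GridFun) :
    pairing Set.univ f g = ∑' j : ℤ, (star (g j) ⬝ᵥ f j).re :=
  tsum_univ fun j => (star (g j) ⬝ᵥ f j).re

theorem le_pairing_stiffOp {h s : ℝ} (hh : 0 < h) (hs : 1 < s) {u : GridFun}
    (hu : Summable (sqNorm u)) :
    (s - 1) * h⁻¹ * ∑' j, ‖u j 1‖ ^ 2 ≤ pairing Set.univ (stiffOp h s u) u := by
  rw [pairing_univ]
  have s0 := (summable_component hu 0).hasSum
  have s1 := (summable_component hu 1).hasSum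
  have hl := (((s0.sub (((hasSum_sub_one s0).add (hasSum_shift s0 1)).div_const 2)).add
    ((s1.mul_left (s - 1)).add
      ((((s1.mul_left 2).sub (hasSum_sub_one s1)).sub (hasSum_shift s1 1)).div_const 8))).mul_left
      h⁻¹)
  have hr : Summable fun j => (star (u j) ⬝ᵥ stiffOp h s u j).re :=
    Summable.of_norm_bounded ((summable_neighbours hu).mul_left ((s + 4) * h⁻¹))
      fun j => abs_re_star_dot_stiffOp_le hh hs u j
  have := hasSum_le (fun j => le_re_star_dot_stiffOp hh s u j) hl hr.hasSum
  refine le_trans (le_of_eq ?_) this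
  ring

theorem pairing_massOp_nonneg {h : ℝ} (hh : 0 < h) {u : GridFun} (hu : Summable (sqNorm u)) :
    0 ≤ pairing Set.univ (massOp h u) u := by
  rw [pairing_univ]
  have s0 := (summable_component hu 0).hasSum
  have s1 := (summable_component hu 1).hasSum
  have hl := (((((s0.mul_left 2).sub (hasSum_sub_one s0)).sub (hasSum_shift s0 1)).div_const 6).add
      ((((s1.mul_left 2).sub (hasSum_sub_one s1)).sub
        (hasSum_shift s1 1)).div_const 24)).mul_left h
  have hr : Summable fun j => (star (u j) ⬝ᵥ massOp h u j).re :=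
    Summable.of_norm_bounded ((summable_neighbours hu).mul_left (2 * h))
      fun j => abs_re_star_dot_massOp_le hh u j
  have := hasSum_le (fun j => le_re_star_dot_massOp hh u j) hl hr.hasSum
  refine le_trans (le_of_eq ?_) this
  ring

/-- The total energy controls the jumps. -/
theorem le_totalEnergy {h s : ℝ} (hh : 0 < h) (hs : 1 < s) {u v : GridFun}
    (hu : Summable (sqNorm u)) (hv : Summable (sqNorm v)) :
    (s - 1) / (2 * h) * ∑' j, ‖u j 1‖ ^ 2 ≤ totalEnergy h s u v := by
  have h1 := le_pairing_stiffOp hh hs hu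
  have h2 := pairing_massOp_nonneg hh hv
  have : (s - 1) / (2 * h) * ∑' j, ‖u j 1‖ ^ 2 = ((s - 1) * h⁻¹ * ∑' j, ‖u j 1‖ ^ 2) / 2 := by
    field_simp
  rw [this]
  simp only [totalEnergy, energyOn]
  linarith

/-- `S'` must contain `S` and its neighbours because the stencils reach one node beyond `S`; the
factor 3 counts the three shifts. -/
theorem abs_pairing_le {S S' : Set ℤ} (hS : ∀ j ∈ S, j - 1 ∈ S' ∧ j ∈ S' ∧ j + 1 ∈ S')
    {u : GridFun} (hu : Summable (sqNorm u)) {A : GridFun → GridFun} {K : ℝ} (hK : 0 ≤ K)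
    (hA : ∀ j, |(star (u j) ⬝ᵥ A u j).re| ≤ K * (sqNorm u (j - 1) + sqNorm u j + sqNorm u (j + 1))) :
    |pairing S (A u) u| ≤ 3 * K * ∑' j, S'.indicator (sqNorm u) j := by
  have hv : Summable (S'.indicator (sqNorm u)) := hu.indicator S'
  have hs1 := ((hasSum_sub_one hv.hasSum).add hv.hasSum).add (hasSum_shift hv.hasSum 1)
  have hs2 := hs1.mul_left K
  have e : pairing S (A u) u = ∑' j, S.indicator (fun j => (star (u j) ⬝ᵥ A u j).re) j :=
    tsum_subtype S fun j => (star (u j) ⬝ᵥ A u j).re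
  rw [e, ← Real.norm_eq_abs]
  refine (tsum_of_norm_bounded hs2 fun j => ?_).trans (le_of_eq (by ring))
  by_cases hj : j ∈ S
  · obtain ⟨h1, h2, h3⟩ := hS j hj
    simp only [Set.indicator_of_mem hj, Set.indicator_of_mem h1, Set.indicator_of_mem h2,
      Set.indicator_of_mem h3]
    exact hA j
  · rw [Set.indicator_of_notMem hj, norm_zero]
    have : ∀ i, 0 ≤ S'.indicator (sqNorm u) i :=
      fun i => Set.indicator_nonneg (fun _ _ => sqNorm_nonneg _ _) _
    exact mul_nonneg hK (add_nonneg (add_nonneg (this _) (this _)) (this _))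

theorem sqNorm_indicator (S : Set ℤ) (u : GridFun) :
    sqNorm (S.indicator u) = S.indicator (sqNorm u) := by
  funext j
  by_cases hj : j ∈ S <;> simp [sqNorm, hj]

/-- The observed energy is controlled by the values near the observation region. -/
theorem abs_obsEnergy_le (loc : Localization) {h s : ℝ} (hh : 0 < h) (hs : 1 < s) {u v : GridFun}
    (hu : Summable (sqNorm u)) (hv : Summable (sqNorm v)) {S' : Set ℤ}
    (hS : ∀ j ∈ obsIndices h, j - 1 ∈ S' ∧ j ∈ S' ∧ j + 1 ∈ S') :
    |obsEnergy loc h s u v| ≤ 3 * (s + 4) *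
      (h⁻¹ * ∑' j, S'.indicator (sqNorm u) j + h * ∑' j, S'.indicator (sqNorm v) j) := by
  have n1 : 0 ≤ ∑' j, S'.indicator (sqNorm u) j :=
    tsum_nonneg fun i => Set.indicator_nonneg (fun _ _ => sqNorm_nonneg _ _) _
  have n2 : 0 ≤ ∑' j, S'.indicator (sqNorm v) j :=
    tsum_nonneg fun i => Set.indicator_nonneg (fun _ _ => sqNorm_nonneg _ _) _
  have p1 : 0 ≤ (s + 4) * h⁻¹ := by have : 0 < s := by linarith
                                    positivity
  have p2 : 0 ≤ 2 * h := by positivity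
  have key : ∀ a b : ℝ, |a| ≤ 3 * ((s + 4) * h⁻¹) * ∑' j, S'.indicator (sqNorm u) j →
      |b| ≤ 3 * (2 * h) * ∑' j, S'.indicator (sqNorm v) j → |(a + b) / 2| ≤ 3 * (s + 4) *
      (h⁻¹ * ∑' j, S'.indicator (sqNorm u) j + h * ∑' j, S'.indicator (sqNorm v) j) := by
    intro a b ha hb
    have q1 : 0 ≤ 3 * ((s + 4) * h⁻¹) * ∑' j, S'.indicator (sqNorm u) j := by positivity
    have q2 : 0 ≤ h * ∑' j, S'.indicator (sqNorm v) j := by positivity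
    have q3 : 0 ≤ s * (h * ∑' j, S'.indicator (sqNorm v) j) := by
      have : 0 < s := by linarith
      positivity
    rw [abs_div, abs_two, div_le_iff₀ two_pos]
    refine (abs_add_le a b).trans ((add_le_add ha hb).trans ?_)
    linarith
  cases loc with
  | pairing =>
    exact key _ _
      (abs_pairing_le hS hu p1 fun j => abs_re_star_dot_stiffOp_le hh hs u j)
      (abs_pairing_le hS hv p2 fun j => abs_re_star_dot_massOp_le hh v j)
  | truncation =>
    -- Here the pairing runs over all nodes but the vectors are truncated, so the bound is applied
    -- with both sets equal to ℤ, and the truncated sums are compared with those over `S'`.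
    have aux : ∀ {w : GridFun}, Summable (sqNorm w) →
        Summable (sqNorm ((obsIndices h).indicator w)) ∧
        ∑' j, sqNorm ((obsIndices h).indicator w) j ≤ ∑' j, S'.indicator (sqNorm w) j := by
      intro w hw
      rw [sqNorm_indicator]
      refine ⟨hw.indicator _, (hw.indicator _).tsum_le_tsum (fun j => ?_) (hw.indicator _)⟩
      exact Set.indicator_le_indicator_of_subset (fun j hj => (hS j hj).2.1)
        (fun _ => sqNorm_nonneg _ _) j
    have aux2 := fun {w : GridFun} (hw : Summable (sqNorm w)) {A : GridFun → GridFun} {K : ℝ}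
      (hK : 0 ≤ K) hA => (abs_pairing_le (S := Set.univ) (S' := Set.univ)
        (fun _ _ => ⟨trivial, trivial, trivial⟩) (aux hw).1 (A := A) hK hA)
    simp only [Set.indicator_univ] at aux2
    refine key _ _ ?_ ?_
    · exact (aux2 hu p1 fun j => abs_re_star_dot_stiffOp_le hh hs _ j).trans
        (mul_le_mul_of_nonneg_left (aux hu).2 (by positivity))
    · exact (aux2 hv p2 fun j => abs_re_star_dot_massOp_le hh _ j).trans
        (mul_le_mul_of_nonneg_left (aux hv).2 (by positivity))

/-! ### Symbols, eigenvalues and dispersion relations -/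

theorem massSymbol_one (η : ℝ) : massSymbol 1 η =
    !![((2 + Real.cos η : ℝ) : ℂ) / 3, Complex.I * ((Real.sin η : ℝ) : ℂ) / 6;
      -Complex.I * ((Real.sin η : ℝ) : ℂ) / 6, ((2 - Real.cos η : ℝ) : ℂ) / 12] := by
  simp only [massSymbol, mul_one, Complex.ofReal_div, Complex.ofReal_ofNat, mul_div_assoc]

theorem stiffSymbol_one (s η : ℝ) : stiffSymbol 1 s η =
    !![((2 - 2 * Real.cos η : ℝ) : ℂ), 0; 0, ((s - (1 + Real.cos η) / 2 : ℝ) : ℂ)] := by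
  have h1 : Real.cos (η / 2) ^ 2 = (1 + Real.cos η) / 2 := by
    rw [Real.cos_sq, mul_div_cancel₀ _ two_ne_zero]; ring
  have h2 : 4 * Real.sin (η / 2) ^ 2 = 2 - 2 * Real.cos η := by
    rw [Real.sin_sq, h1]; ring
  simp only [stiffSymbol, mul_one, one_pow, div_one, h1, h2]

/-- By sin² + cos² = 1 the determinant does not depend on η, so the mass symbol is always
invertible. -/
theorem det_massSymbol_one (η : ℝ) : (massSymbol 1 η).det = 1 / 12 := by
  rw [massSymbol_one, Matrix.det_fin_two_of]
  have := Complex.ofReal_inj.2 (Real.sin_sq_add_cos_sq η)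
  push_cast at this ⊢
  linear_combination (Complex.sin η ^ 2 / 36) * Complex.I_sq - this / 36

/-- Clearing the inverse of the mass matrix gives a generalized eigenvalue problem with explicit
entries. -/
theorem symbol_mulVec_eq_iff (s η Λ : ℝ) (v : Fin 2 → ℂ) :
    symbol 1 s η *ᵥ v = (Λ : ℂ) • v ↔
      (stiffSymbol 1 s η - (Λ : ℂ) • massSymbol 1 η) *ᵥ v = 0 := by
  have hdet : IsUnit (massSymbol 1 η).det := by rw [det_massSymbol_one]; norm_num
  rw [Matrix.sub_mulVec, sub_eq_zero, Matrix.smul_mulVec, symbol, ← Matrix.mulVec_mulVec]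
  constructor
  · intro h
    have := congrArg (fun w => massSymbol 1 η *ᵥ w) h
    simpa only [Matrix.mulVec_mulVec, ← mul_assoc, Matrix.mul_nonsing_inv _ hdet, one_mul,
      Matrix.mulVec_smul] using this
  · intro h
    rw [h, Matrix.mulVec_smul, Matrix.mulVec_mulVec, Matrix.nonsing_inv_mul _ hdet,
      Matrix.one_mulVec]

/-- The two scalar equations satisfied by an eigenvector. -/
theorem eigenvector_equations {s η Λ : ℝ} {v : Fin 2 → ℂ}
    (h : symbol 1 s η *ᵥ v = (Λ : ℂ) • v) :
    ((2 - 2 * Real.cos η : ℝ) : ℂ) * v 0 = Λ * (((2 + Real.cos η : ℝ) : ℂ) / 3 * v 0 +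
        Complex.I * ((Real.sin η : ℝ) : ℂ) / 6 * v 1) ∧
      ((s - (1 + Real.cos η) / 2 : ℝ) : ℂ) * v 1 =
        Λ * (-Complex.I * ((Real.sin η : ℝ) : ℂ) / 6 * v 0 +
          ((2 - Real.cos η : ℝ) : ℂ) / 12 * v 1) := by
  rw [symbol_mulVec_eq_iff, massSymbol_one, stiffSymbol_one] at h
  have h0 := congrFun h 0
  have h1 := congrFun h 1
  simp only [Matrix.mulVec, dotProduct, Fin.sum_univ_two, Matrix.sub_apply, Matrix.smul_apply,
    Matrix.of_apply, Matrix.cons_val_zero, Matrix.cons_val_one, Matrix.cons_val',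
    Matrix.cons_val_fin_one, Pi.zero_apply, smul_eq_mul] at h0 h1
  constructor
  · linear_combination h0
  · linear_combination h1

/-- The trace of `S_1^s(η)`. -/
def symTrace (s η : ℝ) : ℝ :=
  (2 - Real.cos η) * (2 - 2 * Real.cos η) + (2 + Real.cos η) * (4 * s - 2 - 2 * Real.cos η)

/-- The determinant of `S_1^s(η)`. -/
def symDet (s η : ℝ) : ℝ := 12 * (1 - Real.cos η) * (2 * s - 1 - Real.cos η)

/-- The discriminant of the characteristic polynomial of `S_1^s(η)`. -/
def symDisc (s η : ℝ) : ℝ := symTrace s η ^ 2 - 4 * symDet s η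

/-- The position of an eigenvalue relative to the half trace. -/
def Mode.sign : Mode → ℝ
  | .physical => -1
  | .spurious => 1

/-- The eigenvalue of `S_1^s(η)` by the quadratic formula. -/
def symRoot (m : Mode) (s η : ℝ) : ℝ := (symTrace s η + m.sign * Real.sqrt (symDisc s η)) / 2

/-- For a 2×2 matrix the discriminant is the squared difference of the diagonal entries plus four
times the product of the off-diagonal ones. For this symbol that product is nonnegative. -/
theorem symDisc_eq (s η : ℝ) : symDisc s η =
    ((2 - Real.cos η) * (2 - 2 * Real.cos η) - (2 + Real.cos η) * (4 * s - 2 - 2 * Real.cos η)) ^ 2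
      + 16 * (1 - Real.cos η) ^ 2 * (1 + Real.cos η) * (2 * s - 1 - Real.cos η) := by
  simp only [symDisc, symTrace, symDet]; ring

theorem symDisc_nonneg {s : ℝ} (hs : 1 < s) (η : ℝ) : 0 ≤ symDisc s η := by
  rw [symDisc_eq]
  have h1 : 0 ≤ 1 + Real.cos η := by linarith [Real.neg_one_le_cos η]
  have h2 : 0 ≤ 2 * s - 1 - Real.cos η := by linarith [Real.cos_le_one η]
  positivity

theorem neg_one_lt_cos {η : ℝ} (hη : η ∈ Set.Ioo (-Real.pi) Real.pi) : -1 < Real.cos η := by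
  rw [← Real.cos_abs, ← Real.cos_pi]
  exact Real.cos_lt_cos_of_nonneg_of_le_pi (abs_nonneg η) le_rfl (abs_lt.2 hη)

theorem cos_lt_one {η : ℝ} (hη : η ∈ Set.Ioo (-Real.pi) Real.pi) (h0 : η ≠ 0) :
    Real.cos η < 1 := by
  rw [← Real.cos_abs, ← Real.cos_zero]
  exact Real.cos_lt_cos_of_nonneg_of_le_pi le_rfl (abs_lt.2 hη).le (abs_pos.2 h0)

/-- At η = 0 the squared difference is positive because s > 1; elsewhere in the open interval the
off-diagonal product is. The endpoints ±π are excluded: there the product vanishes, and for s = 3 so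
does the difference. -/
theorem symDisc_pos {s : ℝ} (hs : 1 < s) {η : ℝ} (hη : η ∈ Set.Ioo (-Real.pi) Real.pi) :
    0 < symDisc s η := by
  rw [symDisc_eq]
  have h1 := neg_one_lt_cos hη
  have h2 : 0 < 2 * s - 1 - Real.cos η := by linarith [Real.cos_le_one η]
  rcases (Real.cos_le_one η).eq_or_lt with h | h
  · rw [h]; nlinarith
  · have h3 : 0 < 1 - Real.cos η := by linarith
    have h4 : 0 < 1 + Real.cos η := by linarith
    positivity

theorem symTrace_pos {s : ℝ} (hs : 1 < s) (η : ℝ) : 0 < symTrace s η := by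
  have h1 := Real.neg_one_le_cos η
  have h2 := Real.cos_le_one η
  have a1 : 0 ≤ (2 - Real.cos η) * (2 - 2 * Real.cos η) :=
    mul_nonneg (by linarith) (by linarith)
  have a2 : 0 < (2 + Real.cos η) * (4 * s - 2 - 2 * Real.cos η) :=
    mul_pos (by linarith) (by linarith)
  unfold symTrace
  linarith

theorem eigenvalues_one {s : ℝ} (hs : 1 < s) (η : ℝ) :
    eigenvalues 1 s η = {symRoot .physical s η, symRoot .spurious s η} := by
  ext Λ
  have e1 : Λ ∈ eigenvalues 1 s η ↔
      (stiffSymbol 1 s η - (Λ : ℂ) • massSymbol 1 η).det = 0 := by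
    rw [← Matrix.exists_mulVec_eq_zero_iff]
    simp only [eigenvalues, Set.mem_ofPred_eq, symbol_mulVec_eq_iff]
  have e2 : (stiffSymbol 1 s η - (Λ : ℂ) • massSymbol 1 η).det =
      (((Λ ^ 2 - symTrace s η * Λ + symDet s η) / 12 : ℝ) : ℂ) := by
    rw [massSymbol_one, stiffSymbol_one, Matrix.det_fin_two]
    simp only [Matrix.sub_apply, Matrix.smul_apply,
      Matrix.of_apply, Matrix.cons_val_zero, Matrix.cons_val_one, Matrix.cons_val',
      Matrix.cons_val_fin_one, smul_eq_mul, symTrace, symDet]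
    have := Complex.ofReal_inj.2 (Real.sin_sq_add_cos_sq η)
    push_cast at this ⊢
    linear_combination ((Λ : ℂ) ^ 2 * Complex.sin η ^ 2 / 36) * Complex.I_sq -
      this * (Λ : ℂ) ^ 2 / 36
  rw [e1, e2, Complex.ofReal_eq_zero]
  -- Factorization of the characteristic polynomial over its two roots.
  have e3 : (Λ ^ 2 - symTrace s η * Λ + symDet s η) / 12 =
      (Λ - symRoot .physical s η) * (Λ - symRoot .spurious s η) / 12 := by
    have := Real.sq_sqrt (symDisc_nonneg hs η)
    have hd : symDet s η = (symTrace s η ^ 2 - symDisc s η) / 4 := by unfold symDisc; ring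
    simp only [symRoot, Mode.sign]
    rw [hd]
    linear_combination this / 48
  rw [e3, div_eq_zero_iff, mul_eq_zero, sub_eq_zero, sub_eq_zero]
  simp

theorem eigenvalue_one (m : Mode) {s : ℝ} (hs : 1 < s) (η : ℝ) :
    eigenvalue m 1 s η = symRoot m s η := by
  have h : symRoot .physical s η ≤ symRoot .spurious s η := by
    have := Real.sqrt_nonneg (symDisc s η)
    simp only [symRoot, Mode.sign]
    linarith
  cases m <;> simp only [eigenvalue, eigenvalues_one hs]
  · rw [csInf_pair, inf_eq_left.2 h]
  · rw [csSup_pair, sup_eq_right.2 h]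

theorem symRoot_nonneg (m : Mode) {s : ℝ} (hs : 1 < s) (η : ℝ) : 0 ≤ symRoot m s η := by
  have h1 := (symTrace_pos hs η).le
  have h2 : Real.sqrt (symDisc s η) ≤ symTrace s η := by
    apply Real.sqrt_le_iff.2 ⟨h1, ?_⟩
    have : 0 ≤ symDet s η := by
      have h1 : 0 ≤ 1 - Real.cos η := by linarith [Real.cos_le_one η]
      have h2 : 0 ≤ 2 * s - 1 - Real.cos η := by linarith [Real.cos_le_one η]
      unfold symDet
      positivity
    unfold symDisc
    linarith
  have h3 := Real.sqrt_nonneg (symDisc s η)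
  cases m <;> simp only [symRoot, Mode.sign] <;> linarith

theorem symRoot_pos {m : Mode} {s : ℝ} (hs : 1 < s) {η : ℝ}
    (hη : η ∈ Set.Ioo (-Real.pi) Real.pi) (h0 : m = .physical → η ≠ 0) : 0 < symRoot m s η := by
  have h1 := symTrace_pos hs η
  have h3 := Real.sqrt_nonneg (symDisc s η)
  cases m with
  | spurious => simp only [symRoot, Mode.sign]; linarith
  | physical =>
    have h2 : Real.sqrt (symDisc s η) < symTrace s η := by
      apply (Real.sqrt_lt' h1).2
      have : 0 < symDet s η := by
        have h1 : 0 < 1 - Real.cos η := by linarith [cos_lt_one hη (h0 rfl)]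
        have h2 : 0 < 2 * s - 1 - Real.cos η := by linarith [Real.cos_le_one η]
        unfold symDet
        positivity
      unfold symDisc
      linarith
    simp only [symRoot, Mode.sign]; linarith

theorem dispersion_one (m : Mode) {s : ℝ} (hs : 1 < s) :
    dispersion m 1 s = fun η => Real.sqrt (symRoot m s η) := by
  funext η
  rw [dispersion, eigenvalue_one m hs]

theorem dispersion_one_sq (m : Mode) {s : ℝ} (hs : 1 < s) (η : ℝ) :
    dispersion m 1 s η ^ 2 = eigenvalue m 1 s η := by
  rw [dispersion, eigenvalue_one m hs, Real.sq_sqrt (symRoot_nonneg m hs η)]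

theorem contDiff_symTrace (s : ℝ) : ContDiff ℝ (⊤ : ℕ∞) (symTrace s) := by
  unfold symTrace; fun_prop

theorem contDiff_symDisc (s : ℝ) : ContDiff ℝ (⊤ : ℕ∞) (symDisc s) := by
  have := contDiff_symTrace s
  unfold symDisc symDet; fun_prop

theorem continuous_dispersion_one (m : Mode) {s : ℝ} (hs : 1 < s) :
    Continuous (dispersion m 1 s) := by
  rw [dispersion_one m hs]
  have h1 := (contDiff_symTrace s).continuous
  have h2 := (contDiff_symDisc s).continuous
  unfold symRoot
  fun_prop

/-- Two nested square roots: the inner one is smooth since the two eigenvalues are distinct, the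
outer one since the eigenvalue is positive. The latter fails for the physical mode at 0. -/
theorem contDiffAt_dispersion_one {m : Mode} {s : ℝ} (hs : 1 < s) {η : ℝ}
    (hη : η ∈ Set.Ioo (-Real.pi) Real.pi) (h0 : m = .physical → η ≠ 0) :
    ContDiffAt ℝ (⊤ : ℕ∞) (dispersion m 1 s) η := by
  rw [dispersion_one m hs]
  refine ContDiffAt.sqrt ?_ (symRoot_pos hs hη h0).ne'
  refine ContDiffAt.div_const ((contDiff_symTrace s).contDiffAt.add (contDiffAt_const.mul ?_)) _
  exact (contDiff_symDisc s).contDiffAt.sqrt (symDisc_pos hs hη).ne'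

theorem symbol_scaling {h : ℝ} (s ξ : ℝ) :
    symbol h s ξ = (((h ^ 2)⁻¹ : ℝ) : ℂ) • symbol 1 s (h * ξ) := by
  have e1 : massSymbol h ξ = massSymbol 1 (h * ξ) := by
    simp only [massSymbol, mul_one, mul_comm ξ h]
  have e2 : stiffSymbol h s ξ = (((h ^ 2)⁻¹ : ℝ) : ℂ) • stiffSymbol 1 s (h * ξ) := by
    ext i j
    fin_cases i <;> fin_cases j <;> simp [stiffSymbol, mul_comm ξ h] <;> ring
  rw [symbol, symbol, e1, e2, Matrix.mul_smul]

open scoped Pointwise in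
theorem eigenvalues_scaling {h : ℝ} (hh : 0 < h) (s ξ : ℝ) :
    eigenvalues h s ξ = (h ^ 2)⁻¹ • eigenvalues 1 s (h * ξ) := by
  have hp : ((h ^ 2)⁻¹ : ℝ) ≠ 0 := by positivity
  ext Λ
  rw [Set.mem_smul_set_iff_inv_smul_mem₀ hp, inv_inv, smul_eq_mul]
  simp only [eigenvalues, Set.mem_ofPred_eq, symbol_scaling (h := h) s ξ, Matrix.smul_mulVec]
  refine exists_congr fun v => and_congr_right fun _ => ?_
  have hp' : (((h ^ 2)⁻¹ : ℝ) : ℂ) ≠ 0 := Complex.ofReal_ne_zero.2 hp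
  have : (Λ : ℂ) • v = (((h ^ 2)⁻¹ : ℝ) : ℂ) • (((h ^ 2 * Λ : ℝ) : ℂ) • v) := by
    rw [smul_smul, ← Complex.ofReal_mul]
    congr 2
    field_simp
  rw [this]
  exact ⟨fun e => smul_right_injective _ hp' e, fun e => congrArg _ e⟩

open scoped Pointwise in
theorem dispersion_scaling (m : Mode) {h : ℝ} (hh : 0 < h) (s ξ : ℝ) :
    dispersion m h s ξ = h⁻¹ * dispersion m 1 s (h * ξ) := by
  have hp : 0 ≤ ((h ^ 2)⁻¹ : ℝ) := by positivity
  have e : eigenvalue m h s ξ = (h ^ 2)⁻¹ * eigenvalue m 1 s (h * ξ) := by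
    cases m <;> simp only [eigenvalue, eigenvalues_scaling hh]
    · rw [Real.sInf_smul_of_nonneg hp, smul_eq_mul]
    · rw [Real.sSup_smul_of_nonneg hp, smul_eq_mul]
  rw [dispersion, e, Real.sqrt_mul hp, Real.sqrt_inv, Real.sqrt_sq hh.le, dispersion]

/-- The jump component of an eigenvector does not vanish where the eigenvalue is positive. -/
theorem IsEigenvectorField.jump_ne_zero {m : Mode} {s : ℝ} (hs : 1 < s) {P : ℝ → Fin 2 → ℂ}
    (hP : IsEigenvectorField m s P) {η : ℝ}
    (hη : η ∈ Set.Ioo (-Real.pi) Real.pi) (h0 : m = .physical → η ≠ 0) : P η 1 ≠ 0 := by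
  intro h1
  have hΛ : ((eigenvalue m 1 s η : ℝ) : ℂ) ≠ 0 := by
    rw [eigenvalue_one m hs, Complex.ofReal_ne_zero]
    exact (symRoot_pos hs hη h0).ne'
  obtain ⟨e0, e1⟩ := eigenvector_equations (hP.eigen η hη)
  have hP0 : P η 0 ≠ 0 := by
    intro h2
    apply hP.ne_zero η hη
    ext c
    fin_cases c
    · exact h2
    · exact h1
  rw [h1] at e0 e1
  simp only [mul_zero, add_zero] at e0 e1
  -- At η = 0 the first stiffness entry vanishes and the first equation becomes 0 = Λ · P₀.
  -- Elsewhere sin η ≠ 0, and with zero jump the second equation forces Λ sin η · P₀ = 0.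
  by_cases hη0 : η = 0
  · subst hη0
    simp only [Real.cos_zero] at e0
    norm_num at e0
    rcases e0 with e | e
    · exact hΛ (by exact_mod_cast e)
    · exact hP0 e
  · have hsin : Real.sin η ≠ 0 := by
      have h2 := neg_one_lt_cos hη
      have h3 := cos_lt_one hη hη0
      intro h4
      have := Real.sin_sq_add_cos_sq η
      rw [h4] at this
      nlinarith
    have h5 : ((Real.sin η : ℝ) : ℂ) ≠ 0 := Complex.ofReal_ne_zero.2 hsin
    have h6 : ((eigenvalue m 1 s η : ℝ) : ℂ) *
      (-Complex.I * ((Real.sin η : ℝ) : ℂ) / 6 * P η 0) ≠ 0 := by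
      simp only [ne_eq, mul_eq_zero, div_eq_zero_iff, neg_eq_zero, Complex.I_ne_zero, hΛ, h5, hP0,
        OfNat.ofNat_ne_zero, or_self, not_false_eq_true]
    exact h6 e1.symm

/-! ### Parseval's identity and explicit solutions -/

open MeasureTheory

/-- Lebesgue measure on `(-π, π]`. -/
abbrev torusMeasure : Measure ℝ := volume.restrict (Set.Ioc (-Real.pi) Real.pi)

theorem neg_pi_lt_pi : -Real.pi < Real.pi := by linarith [Real.pi_pos]

theorem torusMeasure_eq : torusMeasure = volume.restrict (Set.Ioo (-Real.pi) Real.pi) :=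
  Measure.restrict_congr_set Ioo_ae_eq_Ioc.symm

/-- The eigenvector field is controlled on the open interval only; the endpoint of the torus is a
null set. -/
theorem ae_torus {p : ℝ → Prop} (h : ∀ η ∈ Set.Ioo (-Real.pi) Real.pi, p η) :
    ∀ᵐ η ∂torusMeasure, p η := by
  rw [torusMeasure_eq]
  exact (ae_restrict_iff' measurableSet_Ioo).2 (Filter.Eventually.of_forall h)

/-- The inverse semi-discrete Fourier transform on the unit grid. -/
def sdft (f : ℝ → ℂ) (j : ℤ) : ℂ :=
  ((2 * Real.pi)⁻¹ : ℝ) *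
    ∫ η in (-Real.pi)..Real.pi, f η * Complex.exp (Complex.I * (η * j : ℝ))

theorem sdft_eq_integral (f : ℝ → ℂ) (j : ℤ) : sdft f j =
    ((2 * Real.pi)⁻¹ : ℝ) * ∫ η, f η * Complex.exp (Complex.I * (η * j : ℝ)) ∂torusMeasure := by
  rw [sdft, intervalIntegral.integral_of_le neg_pi_lt_pi.le]

theorem sdft_congr {f g : ℝ → ℂ} (h : ∀ η ∈ Set.Ioo (-Real.pi) Real.pi, f η = g η) (j : ℤ) :
    sdft f j = sdft g j := by
  rw [sdft_eq_integral, sdft_eq_integral]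
  congr 1
  refine integral_congr_ae ((ae_torus h).mono fun η e => ?_)
  simp only [e]

theorem sdft_const_mul (a : ℂ) (f : ℝ → ℂ) (j : ℤ) : sdft (fun η => a * f η) j = a * sdft f j := by
  simp only [sdft_eq_integral, mul_assoc, integral_const_mul]
  ring

theorem norm_exp_I_mul (x : ℝ) : ‖Complex.exp (Complex.I * (x : ℂ))‖ = 1 := by
  rw [mul_comm, Complex.norm_exp_ofReal_mul_I]

theorem integrable_sdft {f : ℝ → ℂ} (hf : MemLp f 2 torusMeasure) (j : ℤ) :
    Integrable (fun η => f η * Complex.exp (Complex.I * (η * j : ℝ))) torusMeasure := by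
  refine (hf.integrable one_le_two).mono ?_ (Filter.Eventually.of_forall fun η => ?_)
  · exact hf.1.mul (by fun_prop : Continuous fun η : ℝ =>
      Complex.exp (Complex.I * (η * j : ℝ))).aestronglyMeasurable
  · rw [norm_mul, norm_exp_I_mul, mul_one]

theorem sdft_add {f g : ℝ → ℂ} (hf : MemLp f 2 torusMeasure) (hg : MemLp g 2 torusMeasure)
    (j : ℤ) : sdft (fun η => f η + g η) j = sdft f j + sdft g j := by
  simp only [sdft_eq_integral, add_mul]
  rw [integral_add (integrable_sdft hf j) (integrable_sdft hg j), mul_add]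

theorem sdft_sub {f g : ℝ → ℂ} (hf : MemLp f 2 torusMeasure) (hg : MemLp g 2 torusMeasure)
    (j : ℤ) : sdft (fun η => f η - g η) j = sdft f j - sdft g j := by
  simp only [sdft_eq_integral, sub_mul]
  rw [integral_sub (integrable_sdft hf j) (integrable_sdft hg j), mul_sub]

theorem sdft_add_int (f : ℝ → ℂ) (j k : ℤ) :
    sdft f (j + k) = sdft (fun η => Complex.exp (Complex.I * (η * k : ℝ)) * f η) j := by
  simp only [sdft]
  congr 2
  funext η
  rw [mul_right_comm, ← Complex.exp_add, mul_comm]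
  push_cast
  ring_nf

theorem hasSum_sq_sdft {f : ℝ → ℂ} (hf : MemLp f 2 torusMeasure) :
    HasSum (fun j => ‖sdft f j‖ ^ 2) ((2 * Real.pi)⁻¹ * ∫ η in (-Real.pi)..Real.pi, ‖f η‖ ^ 2) := by
  -- Fourier coefficients integrate against exp(-ijη), the inverse transform against exp(ijη); hence
  -- the reflection of the index.
  have h := (Equiv.neg ℤ).hasSum_iff.2 (hasSum_sq_fourierCoeffOn neg_pi_lt_pi hf)
  have e : Real.pi - -Real.pi = 2 * Real.pi := by ring
  convert h using 1
  · funext j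
    simp only [Function.comp, Equiv.neg_apply, fourierCoeffOn_eq_integral, neg_neg, sdft]
    rw [e, Complex.real_smul, one_div]
    congr 3
    refine congrArg (fun g : ℝ → ℂ => ∫ η in (-Real.pi)..Real.pi, g η) (funext fun η => ?_)
    rw [smul_eq_mul, mul_comm, fourier_coe_apply]
    congr 2
    have : (Real.pi : ℂ) ≠ 0 := Complex.ofReal_ne_zero.2 Real.pi_ne_zero
    push_cast
    field_simp
  · rw [e, smul_eq_mul]

theorem memLp_smul_exp {f : ℝ → ℂ} (hf : MemLp f 2 torusMeasure) {u : ℝ → ℂ}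
    (hu : AEStronglyMeasurable u torusMeasure) {K : ℝ}
    (hK : ∀ η ∈ Set.Ioo (-Real.pi) Real.pi, ‖u η‖ ≤ K) :
    MemLp (fun η => u η * f η) 2 torusMeasure := by
  refine hf.of_le_mul (c := K) (hu.mul hf.1) (ae_torus fun η hη => ?_)
  rw [norm_mul]
  exact mul_le_mul_of_nonneg_right (hK η hη) (norm_nonneg _)

/-- The componentwise inverse semi-discrete Fourier transform on the unit grid. -/
def sdftVec (F : ℝ → Fin 2 → ℂ) : GridFun := fun j c => sdft (fun η => F η c) j

theorem hasSum_sqNorm_sdftVec {F : ℝ → Fin 2 → ℂ}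
    (hF : ∀ c, MemLp (fun η => F η c) 2 torusMeasure) :
    HasSum (sqNorm (sdftVec F))
      ((2 * Real.pi)⁻¹ * ∫ η in (-Real.pi)..Real.pi, (‖F η 0‖ ^ 2 + ‖F η 1‖ ^ 2)) := by
  have := (hasSum_sq_sdft (hF 0)).add (hasSum_sq_sdft (hF 1))
  have hi : ∀ c, IntervalIntegrable (fun η => ‖F η c‖ ^ 2) volume (-Real.pi) Real.pi := fun c =>
    (intervalIntegrable_iff_integrableOn_Ioc_of_le neg_pi_lt_pi.le).2
      ((memLp_two_iff_integrable_sq_norm (hF c).1).1 (hF c))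
  rw [← mul_add, ← intervalIntegral.integral_add (hi 0) (hi 1)] at this
  exact this

theorem memℓp_of_summable {u : GridFun} (hu : Summable (sqNorm u)) :
    Memℓp (E := fun _ : ℤ => EuclideanSpace ℂ (Fin 2)) (fun j => WithLp.toLp 2 (u j)) 2 := by
  refine memℓp_gen ?_
  have : Summable fun j => ‖u j 0‖ ^ 2 + ‖u j 1‖ ^ 2 := hu
  simpa [EuclideanSpace.norm_sq_eq, Fin.sum_univ_two] using this

/-- The element of `ℓ²` with given Fourier transform. -/
def gridOf (F : ℝ → Fin 2 → ℂ) (hF : ∀ c, MemLp (fun η => F η c) 2 torusMeasure) : GridState :=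
  ⟨fun j => WithLp.toLp 2 (sdftVec F j), memℓp_of_summable (hasSum_sqNorm_sdftVec hF).summable⟩

theorem coords_gridOf (F : ℝ → Fin 2 → ℂ) (hF : ∀ c, MemLp (fun η => F η c) 2 torusMeasure) :
    coords (gridOf F hF) = sdftVec F := rfl

theorem norm_sq_gridOf (F : ℝ → Fin 2 → ℂ) (hF : ∀ c, MemLp (fun η => F η c) 2 torusMeasure) :
    ‖gridOf F hF‖ ^ 2 =
      (2 * Real.pi)⁻¹ * ∫ η in (-Real.pi)..Real.pi, (‖F η 0‖ ^ 2 + ‖F η 1‖ ^ 2) := by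
  have h := lp.hasSum_norm (by norm_num : 0 < (2 : ENNReal).toReal) (gridOf F hF)
  have h2 := hasSum_sqNorm_sdftVec hF
  refine HasSum.unique ?_ h2
  convert h using 1
  · funext j
    simp [gridOf, EuclideanSpace.norm_sq_eq, Fin.sum_univ_two, sqNorm]
  · simp

theorem intervalIntegrable_sq {F : ℝ → Fin 2 → ℂ}
    (hF : ∀ c, MemLp (fun η => F η c) 2 torusMeasure) :
    IntervalIntegrable (fun η => ‖F η 0‖ ^ 2 + ‖F η 1‖ ^ 2) volume (-Real.pi) Real.pi :=
  (intervalIntegrable_iff_integrableOn_Ioc_of_le neg_pi_lt_pi.le).2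
    (((memLp_two_iff_integrable_sq_norm (hF 0).1).1 (hF 0)).add
      ((memLp_two_iff_integrable_sq_norm (hF 1).1).1 (hF 1)))

/-- Parseval turns a pointwise comparison of transforms into one of ℓ²-norms. -/
theorem norm_gridOf_le {F G : ℝ → Fin 2 → ℂ} (hF : ∀ c, MemLp (fun η => F η c) 2 torusMeasure)
    (hG : ∀ c, MemLp (fun η => G η c) 2 torusMeasure) {ε : ℝ} (hε : 0 ≤ ε)
    (h : ∀ η ∈ Set.Ioo (-Real.pi) Real.pi, ∀ c, ‖F η c‖ ≤ ε * ‖G η c‖) :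
    ‖gridOf F hF‖ ≤ ε * ‖gridOf G hG‖ := by
  refine le_of_sq_le_sq ?_ (by positivity)
  rw [mul_pow, norm_sq_gridOf, norm_sq_gridOf, mul_left_comm]
  refine mul_le_mul_of_nonneg_left ?_ (by positivity [Real.pi_pos])
  rw [← intervalIntegral.integral_const_mul]
  refine intervalIntegral.integral_mono_ae_restrict neg_pi_lt_pi.le (intervalIntegrable_sq hF)
    ((intervalIntegrable_sq hG).const_mul _) ?_
  rw [Measure.restrict_congr_set Ioo_ae_eq_Icc.symm]
  refine (ae_restrict_iff' measurableSet_Ioo).2 (Filter.Eventually.of_forall fun η hη => ?_)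
  have h0 := pow_le_pow_left₀ (norm_nonneg _) (h η hη 0) 2
  have h1 := pow_le_pow_left₀ (norm_nonneg _) (h η hη 1) 2
  simp only
  linarith

/-- The Fourier transform at time `t` of the wave with initial datum `F` and frequency `ω`. -/
def waveTransform (ω : ℝ → ℝ) (F : ℝ → Fin 2 → ℂ) (t η : ℝ) (c : Fin 2) : ℂ :=
  Complex.exp (Complex.I * (ω η * t : ℝ)) * F η c

/-- The Fourier transform of the velocity of a wave. -/
def waveVelocity (ω : ℝ → ℝ) (F : ℝ → Fin 2 → ℂ) (η : ℝ) (c : Fin 2) : ℂ :=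
  Complex.I * (ω η : ℂ) * F η c

theorem memLp_waveTransform {ω : ℝ → ℝ} (hω : Continuous ω) {F : ℝ → Fin 2 → ℂ}
    (hF : ∀ c, MemLp (fun η => F η c) 2 torusMeasure) (t : ℝ) (c : Fin 2) :
    MemLp (fun η => waveTransform ω F t η c) 2 torusMeasure :=
  memLp_smul_exp (hF c) (K := 1)
    (by fun_prop : Continuous fun η : ℝ =>
      Complex.exp (Complex.I * (ω η * t : ℝ))).aestronglyMeasurable
    fun η _ => (norm_exp_I_mul _).le

theorem exists_bound_of_continuous {ω : ℝ → ℝ} (hω : Continuous ω) :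
    ∃ K, 0 < K ∧ ∀ η ∈ Set.Ioo (-Real.pi) Real.pi, |ω η| ≤ K := by
  obtain ⟨K, hK⟩ := isCompact_Icc.exists_bound_of_continuousOn
    (hω.continuousOn (s := Set.Icc (-Real.pi) Real.pi))
  refine ⟨max K 1, by positivity, fun η hη => ?_⟩
  exact (hK η (Set.Ioo_subset_Icc_self hη)).trans (le_max_left _ _)

theorem memLp_waveVelocity {ω : ℝ → ℝ} (hω : Continuous ω) {F : ℝ → Fin 2 → ℂ}
    (hF : ∀ c, MemLp (fun η => F η c) 2 torusMeasure) (c : Fin 2) :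
    MemLp (fun η => waveVelocity ω F η c) 2 torusMeasure := by
  obtain ⟨K, -, hK⟩ := exists_bound_of_continuous hω
  refine memLp_smul_exp (hF c) (K := K)
    (by fun_prop : Continuous fun η : ℝ => Complex.I * (ω η : ℂ)).aestronglyMeasurable
    fun η hη => ?_
  rw [norm_mul, Complex.norm_I, one_mul, Complex.norm_real]
  exact hK η hη

/-- The frequency is bounded on the torus, so the Taylor remainder of the exponential is O((t' -
t)²) uniformly in η; Parseval transfers this to the norm of ℓ². -/
theorem hasDerivAt_gridOf {ω : ℝ → ℝ} (hω : Continuous ω) {F : ℝ → Fin 2 → ℂ}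
    (hF : ∀ c, MemLp (fun η => F η c) 2 torusMeasure) (t : ℝ) :
    HasDerivAt (fun t => gridOf (waveTransform ω F t) (memLp_waveTransform hω hF t))
      (gridOf (waveTransform ω (waveVelocity ω F) t)
        (memLp_waveTransform hω (memLp_waveVelocity hω hF) t)) t := by
  obtain ⟨K, hK0, hK⟩ := exists_bound_of_continuous hω
  set G := gridOf F hF
  rw [hasDerivAt_iff_isLittleO]
  have hO : (fun t' => gridOf (waveTransform ω F t') (memLp_waveTransform hω hF t') -
      gridOf (waveTransform ω F t) (memLp_waveTransform hω hF t) -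
      (t' - t) • (gridOf (waveTransform ω (waveVelocity ω F) t)
        (memLp_waveTransform hω (memLp_waveVelocity hω hF) t))) =O[nhds t]
      fun t' => (t' - t) ^ 2 := by
    refine Asymptotics.IsBigO.of_bound (K ^ 2 * ‖G‖) ?_
    have : ∀ᶠ t' in nhds t, K * |t' - t| < 1 := by
      have : Continuous fun t' => K * |t' - t| := by fun_prop
      exact this.continuousAt.eventually_lt continuousAt_const (by simp)
    filter_upwards [this] with t' ht'
    have hR : ∀ c, MemLp (fun η => waveTransform ω F t' η c - waveTransform ω F t η c -
        ((t' - t : ℝ) : ℂ) * waveTransform ω (waveVelocity ω F) t η c) 2 torusMeasure := fun c =>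
      ((memLp_waveTransform hω hF t' c).sub (memLp_waveTransform hω hF t c)).sub
        ((memLp_waveTransform hω (memLp_waveVelocity hω hF) t c).const_mul _)
    have e : gridOf (waveTransform ω F t') (memLp_waveTransform hω hF t') -
      gridOf (waveTransform ω F t) (memLp_waveTransform hω hF t) -
      (t' - t) • (gridOf (waveTransform ω (waveVelocity ω F) t)
        (memLp_waveTransform hω (memLp_waveVelocity hω hF) t)) = gridOf _ hR := by
      ext j c
      have s1 := sdft_sub (f := fun η => waveTransform ω F t' η c - waveTransform ω F t η c)
        ((memLp_waveTransform hω hF t' c).sub (memLp_waveTransform hω hF t c))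
        ((memLp_waveTransform hω (memLp_waveVelocity hω hF) t c).const_mul ((t' - t : ℝ) : ℂ)) j
      have s2 := sdft_sub (memLp_waveTransform hω hF t' c) (memLp_waveTransform hω hF t c) j
      have s3 := sdft_const_mul ((t' - t : ℝ) : ℂ)
        (fun η => waveTransform ω (waveVelocity ω F) t η c) j
      rw [s2, s3] at s1
      exact s1.symm
    rw [e]
    have hb := norm_gridOf_le hR hF (ε := K ^ 2 * (t' - t) ^ 2) (by positivity) ?_
    · refine hb.trans (le_of_eq ?_)
      rw [Real.norm_eq_abs, abs_of_nonneg (sq_nonneg _)]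
      ring
    · intro η hη c
      have hz : ‖Complex.I * ((ω η * (t' - t) : ℝ) : ℂ)‖ ≤ K * |t' - t| := by
        rw [norm_mul, Complex.norm_I, one_mul, Complex.norm_real, Real.norm_eq_abs, abs_mul]
        exact mul_le_mul_of_nonneg_right (hK η hη) (abs_nonneg _)
      have h1 := Complex.norm_exp_sub_one_sub_id_le (hz.trans ht'.le)
      have h2 : waveTransform ω F t' η c - waveTransform ω F t η c -
          ((t' - t : ℝ) : ℂ) * waveTransform ω (waveVelocity ω F) t η c =
          Complex.exp (Complex.I * (ω η * t : ℝ)) *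
            (Complex.exp (Complex.I * ((ω η * (t' - t) : ℝ) : ℂ)) - 1 -
              Complex.I * ((ω η * (t' - t) : ℝ) : ℂ)) * F η c := by
        have : Complex.exp (Complex.I * (ω η * t' : ℝ)) =
            Complex.exp (Complex.I * (ω η * t : ℝ)) *
              Complex.exp (Complex.I * ((ω η * (t' - t) : ℝ) : ℂ)) := by
          rw [← Complex.exp_add]
          push_cast
          ring_nf
        simp only [waveTransform, waveVelocity, this]
        push_cast
        ring
      rw [h2, norm_mul, norm_mul, norm_exp_I_mul, one_mul]
      refine mul_le_mul_of_nonneg_right (h1.trans ?_) (norm_nonneg _)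
      refine (pow_le_pow_left₀ (norm_nonneg _) hz 2).trans (le_of_eq ?_)
      rw [mul_pow, sq_abs]
  refine hO.trans_isLittleO ?_
  have : (fun x : ℝ => x ^ 2) =o[nhds 0] fun x => x := by
    simpa using Asymptotics.isLittleO_pow_pow (𝕜 := ℝ) (m := 1) (n := 2) (by norm_num)
  have ht : Filter.Tendsto (fun t' => t' - t) (nhds t) (nhds 0) := by
    have : Continuous fun t' : ℝ => t' - t := by fun_prop
    simpa using this.tendsto t
  exact this.comp_tendsto ht

/-- The symbol of a stencil. -/
def stencilSymbol (L D R : Matrix (Fin 2) (Fin 2) ℂ) (η : ℝ) : Matrix (Fin 2) (Fin 2) ℂ :=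
  Complex.exp (Complex.I * (η * (-1 : ℤ) : ℝ)) • L + D +
    Complex.exp (Complex.I * (η * (1 : ℤ) : ℝ)) • R

theorem memLp_exp_mul {f : ℝ → ℂ} (hf : MemLp f 2 torusMeasure) (k : ℤ) :
    MemLp (fun η => Complex.exp (Complex.I * (η * k : ℝ)) * f η) 2 torusMeasure :=
  memLp_smul_exp hf (K := 1) (by fun_prop : Continuous fun η : ℝ =>
      Complex.exp (Complex.I * (η * k : ℝ))).aestronglyMeasurable
    fun η _ => (norm_exp_I_mul _).le

theorem memLp_mulVec {F : ℝ → Fin 2 → ℂ}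
    (hF : ∀ c, MemLp (fun η => F η c) 2 torusMeasure) (A : Matrix (Fin 2) (Fin 2) ℂ) (c : Fin 2) :
    MemLp (fun η => (A *ᵥ F η) c) 2 torusMeasure := by
  simp only [Matrix.mulVec, dotProduct, Fin.sum_univ_two]
  exact ((hF 0).const_mul _).add ((hF 1).const_mul _)

theorem mulVec_sdftVec {F : ℝ → Fin 2 → ℂ}
    (hF : ∀ c, MemLp (fun η => F η c) 2 torusMeasure) (A : Matrix (Fin 2) (Fin 2) ℂ) (j : ℤ)
    (c : Fin 2) : (A *ᵥ sdftVec F j) c = sdft (fun η => (A *ᵥ F η) c) j := by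
  simp only [Matrix.mulVec, dotProduct, Fin.sum_univ_two, sdftVec]
  rw [sdft_add ((hF 0).const_mul _) ((hF 1).const_mul _), sdft_const_mul, sdft_const_mul]

/-- A shift by k nodes is multiplication by exp(ikη) on the Fourier side. -/
theorem stencilOp_sdftVec (L D R : Matrix (Fin 2) (Fin 2) ℂ) {F : ℝ → Fin 2 → ℂ}
    (hF : ∀ c, MemLp (fun η => F η c) 2 torusMeasure) :
    stencilOp L D R (sdftVec F) = sdftVec fun η => stencilSymbol L D R η *ᵥ F η := by
  funext j c
  have hsh : ∀ k : ℤ, sdftVec F (j + k) =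
      sdftVec (fun η => Complex.exp (Complex.I * (η * k : ℝ)) • F η) j := by
    intro k
    funext c
    exact sdft_add_int _ _ _
  have hFk : ∀ (k : ℤ) c, MemLp (fun η => (Complex.exp (Complex.I * (η * k : ℝ)) • F η) c) 2
      torusMeasure := fun k c => memLp_exp_mul (hF c) k
  simp only [stencilOp, Pi.add_apply, sub_eq_add_neg j 1, hsh (-1), hsh 1]
  rw [mulVec_sdftVec (hFk (-1)), mulVec_sdftVec hF, mulVec_sdftVec (hFk 1),
    ← sdft_add (memLp_mulVec (hFk (-1)) _ _) (memLp_mulVec hF _ _),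
    ← sdft_add (f := fun η => (L *ᵥ (Complex.exp (Complex.I * (η * (-1 : ℤ) : ℝ)) • F η)) c +
      (D *ᵥ F η) c) ((memLp_mulVec (hFk (-1)) _ _).add (memLp_mulVec hF _ _))
      (memLp_mulVec (hFk 1) _ _)]
  simp only [sdftVec, stencilSymbol, Matrix.add_mulVec, Matrix.smul_mulVec, Matrix.mulVec_smul,
    Pi.add_apply]

theorem exp_neg_one (η : ℝ) : Complex.exp (Complex.I * (η * (-1 : ℤ) : ℝ)) =
    (Real.cos η : ℂ) - (Real.sin η : ℂ) * Complex.I := by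
  have : Complex.I * ((η * ((-1 : ℤ) : ℝ) : ℝ) : ℂ) = ((-η : ℝ) : ℂ) * Complex.I := by
    push_cast; ring
  rw [this, Complex.exp_mul_I]
  push_cast
  rw [Complex.cos_neg, Complex.sin_neg]
  ring

theorem exp_pos_one (η : ℝ) : Complex.exp (Complex.I * (η * (1 : ℤ) : ℝ)) =
    (Real.cos η : ℂ) + (Real.sin η : ℂ) * Complex.I := by
  have : Complex.I * ((η * ((1 : ℤ) : ℝ) : ℝ) : ℂ) = (η : ℂ) * Complex.I := by
    push_cast; ring
  rw [this, Complex.exp_mul_I]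
  push_cast
  ring

theorem massOp_sdftVec (h : ℝ) {F : ℝ → Fin 2 → ℂ}
    (hF : ∀ c, MemLp (fun η => F η c) 2 torusMeasure) :
    massOp h (sdftVec F) = sdftVec fun η => ((h : ℂ) • massSymbol 1 η) *ᵥ F η := by
  rw [massOp, stencilOp_sdftVec _ _ _ hF]
  congr 1
  funext η
  congr 1
  rw [stencilSymbol, exp_neg_one, exp_pos_one, massSymbol_one]
  ext i j
  fin_cases i <;> fin_cases j <;> simp <;> ring

theorem stiffOp_sdftVec (h s : ℝ) {F : ℝ → Fin 2 → ℂ}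
    (hF : ∀ c, MemLp (fun η => F η c) 2 torusMeasure) :
    stiffOp h s (sdftVec F) = sdftVec fun η => ((h : ℂ)⁻¹ • stiffSymbol 1 s η) *ᵥ F η := by
  rw [stiffOp, stencilOp_sdftVec _ _ _ hF]
  congr 1
  funext η
  congr 1
  rw [stencilSymbol, exp_neg_one, exp_pos_one, stiffSymbol_one]
  ext i j
  fin_cases i <;> fin_cases j <;> simp <;> ring

theorem memLp_smul_field {p : ℝ → Fin 2 → ℂ}
    (hp : ContinuousOn p (Set.Ioo (-Real.pi) Real.pi)) {K : ℝ}
    (hK : ∀ η ∈ Set.Ioo (-Real.pi) Real.pi, ‖p η‖ ≤ K)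
    {g : ℝ → ℂ} (hg : MemLp g 2 torusMeasure) (c : Fin 2) :
    MemLp (fun η => (g η • p η) c) 2 torusMeasure := by
  have hm : AEStronglyMeasurable (fun η => p η c) torusMeasure := by
    rw [torusMeasure_eq]
    exact (continuousOn_pi.1 hp c).aestronglyMeasurable measurableSet_Ioo
  have := memLp_smul_exp hg hm (K := K) fun η hη => (norm_le_pi_norm _ c).trans (hK η hη)
  simpa only [Pi.smul_apply, smul_eq_mul, mul_comm] using this

/-- Solutions concentrated on one mode. -/
theorem exists_isSolution {m : Mode} {s : ℝ} (hs : 1 < s) {P : ℝ → Fin 2 → ℂ}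
    (hP : IsEigenvectorField m s P) {h : ℝ} (hh : 0 < h) {g : ℝ → ℂ}
    (hg : MemLp g 2 torusMeasure) :
    ∃ U V : ℝ → GridState, IsSolution h s U V ∧
      (∀ t, coords (U t) = sdftVec fun η =>
        (Complex.exp (Complex.I * (h⁻¹ * dispersion m 1 s η * t : ℝ)) * g η) • P η) ∧
      (∀ t, coords (V t) = sdftVec fun η =>
        (Complex.exp (Complex.I * (h⁻¹ * dispersion m 1 s η * t : ℝ)) *
          (Complex.I * (h⁻¹ * dispersion m 1 s η : ℝ) * g η)) • P η) := by
  set ω : ℝ → ℝ := fun η => h⁻¹ * dispersion m 1 s η with hωdef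
  have hω : Continuous ω := continuous_const.mul (continuous_dispersion_one m hs)
  set F : ℝ → Fin 2 → ℂ := fun η => g η • P η with hFdef
  have hF : ∀ c, MemLp (fun η => F η c) 2 torusMeasure :=
    memLp_smul_field hP.smooth.continuousOn hP.bounded.choose_spec hg
  have hF1 := memLp_waveVelocity hω hF
  have hF2 := memLp_waveVelocity hω hF1
  refine ⟨fun t => gridOf _ (memLp_waveTransform hω hF t),
    fun t => gridOf _ (memLp_waveTransform hω hF1 t),
    ⟨fun t => gridOf _ (memLp_waveTransform hω hF2 t), fun t =>
      ⟨hasDerivAt_gridOf hω hF t, hasDerivAt_gridOf hω hF1 t, ?_⟩⟩, fun t => ?_, fun t => ?_⟩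
  · rw [coords_gridOf, coords_gridOf, massOp_sdftVec _ (memLp_waveTransform hω hF2 t),
      stiffOp_sdftVec _ _ (memLp_waveTransform hω hF t)]
    have hcont : ∀ {A : ℝ → Matrix (Fin 2) (Fin 2) ℂ} (_ : Continuous A) {G : ℝ → Fin 2 → ℂ}
        (_ : ∀ c, MemLp (fun η => G η c) 2 torusMeasure) (c : Fin 2),
        MemLp (fun η => (A η *ᵥ G η) c) 2 torusMeasure := by
      intro A hA G hG c
      have hb : ∀ i, MemLp (fun η => A η c i * G η i) 2 torusMeasure := by
        intro i
        have hc : Continuous fun η => A η c i := by fun_prop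
        obtain ⟨K, -, hK⟩ := exists_bound_of_continuous hc.norm
        exact memLp_smul_exp (hG i) hc.aestronglyMeasurable fun η hη =>
          (le_abs_self _).trans (hK η hη)
      simp only [Matrix.mulVec, dotProduct, Fin.sum_univ_two]
      exact (hb 0).add (hb 1)
    have hM : Continuous fun η => (h : ℂ) • massSymbol 1 η := by
      refine continuous_matrix fun i j => ?_
      simp only [massSymbol_one]
      fin_cases i <;> fin_cases j <;> simp <;> fun_prop
    have hR : Continuous fun η => (h : ℂ)⁻¹ • stiffSymbol 1 s η := by
      refine continuous_matrix fun i j => ?_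
      simp only [stiffSymbol_one]
      fin_cases i <;> fin_cases j <;> simp <;> fun_prop
    funext j c
    simp only [Pi.add_apply, sdftVec, Pi.zero_apply]
    rw [← sdft_add (hcont hM (memLp_waveTransform hω hF2 t) c)
      (hcont hR (memLp_waveTransform hω hF t) c)]
    rw [sdft_congr (g := fun _ => 0), sdft]
    · simp
    · intro η hη
      -- The eigenvector equation in the form R P = λ² M P. Since the second time derivative
      -- contributes -(λ/h)², the terms h M and h⁻¹ R cancel.
      have he := (symbol_mulVec_eq_iff s η _ _).1 (hP.eigen η hη)
      rw [Matrix.sub_mulVec, sub_eq_zero, ← dispersion_one_sq m hs] at he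
      have e1 : waveTransform ω F t η =
          (Complex.exp (Complex.I * (ω η * t : ℝ)) * g η) • P η := by
        funext c
        simp only [waveTransform, hFdef, Pi.smul_apply, smul_eq_mul]
        ring
      have e2 : waveTransform ω (waveVelocity ω (waveVelocity ω F)) t η =
          (-(ω η : ℂ) ^ 2 * (Complex.exp (Complex.I * (ω η * t : ℝ)) * g η)) • P η := by
        funext c
        simp only [waveTransform, waveVelocity, hFdef, Pi.smul_apply, smul_eq_mul]
        linear_combination (Complex.exp (Complex.I * (ω η * t : ℝ)) * g η * (ω η : ℂ) ^ 2 *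
          P η c) * Complex.I_sq
      rw [e1, e2, Matrix.mulVec_smul, Matrix.mulVec_smul, Matrix.smul_mulVec, Matrix.smul_mulVec,
        he, Matrix.smul_mulVec]
      simp only [Pi.smul_apply, smul_eq_mul, hωdef]
      have : (h : ℂ) ≠ 0 := Complex.ofReal_ne_zero.2 hh.ne'
      push_cast
      field_simp
      ring
  · rw [coords_gridOf]
    congr 1
    funext η c
    simp only [waveTransform, hFdef, Pi.smul_apply, smul_eq_mul, hωdef]
    ring
  · rw [coords_gridOf]
    congr 1
    funext η c
    simp only [waveTransform, waveVelocity, hFdef, Pi.smul_apply, smul_eq_mul, hωdef]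
    ring

/-! ### Non-stationary phase, uniformly in parameters -/

/-- The functions of the family `f` have derivatives up to the order `n`, all of which are bounded
by a multiple of the weight `w`, uniformly in the index. -/
def SymbolBound {ι : Type*} (w : ℝ → ℝ) : ℕ → (ι → ℝ → ℂ) → Prop
  | 0, f => (∀ i, Continuous (f i)) ∧ ∃ C, ∀ i x, ‖f i x‖ ≤ C * w x
  | n + 1, f => (∃ C, ∀ i x, ‖f i x‖ ≤ C * w x) ∧
      ∃ f' : ι → ℝ → ℂ, (∀ i x, HasDerivAt (f i) (f' i x) x) ∧ SymbolBound w n f'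

namespace SymbolBound

variable {ι : Type*} {w : ℝ → ℝ} {n : ℕ} {f g : ι → ℝ → ℂ}

theorem bound (hf : SymbolBound w n f) : ∃ C, ∀ i x, ‖f i x‖ ≤ C * w x := by
  cases n with
  | zero => exact hf.2
  | succ n => exact hf.1

theorem continuous (hf : SymbolBound w n f) (i : ι) : Continuous (f i) := by
  cases n with
  | zero => exact hf.1 i
  | succ n =>
    obtain ⟨-, f', h, -⟩ := hf
    exact continuous_iff_continuousAt.2 fun x => (h i x).continuousAt

theorem of_succ (hf : SymbolBound w (n + 1) f) : SymbolBound w n f := by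
  induction n generalizing f with
  | zero => exact ⟨hf.continuous, hf.bound⟩
  | succ n ih =>
    obtain ⟨h0, f', h1, h2⟩ := hf
    exact ⟨h0, f', h1, ih h2⟩

theorem add (hf : SymbolBound w n f) (hg : SymbolBound w n g) :
    SymbolBound w n (fun i x => f i x + g i x) := by
  induction n generalizing f g with
  | zero =>
    obtain ⟨hf0, C, hC⟩ := hf
    obtain ⟨hg0, D, hD⟩ := hg
    refine ⟨fun i => (hf0 i).add (hg0 i), C + D, fun i x => ?_⟩
    rw [add_mul]
    exact (norm_add_le _ _).trans (add_le_add (hC i x) (hD i x))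
  | succ n ih =>
    obtain ⟨⟨C, hC⟩, f', hf1, hf2⟩ := hf
    obtain ⟨⟨D, hD⟩, g', hg1, hg2⟩ := hg
    refine ⟨⟨C + D, fun i x => ?_⟩, _, fun i x => (hf1 i x).add (hg1 i x), ih hf2 hg2⟩
    rw [add_mul]
    exact (norm_add_le _ _).trans (add_le_add (hC i x) (hD i x))

theorem exists_bound_mul (hf : ∃ C, ∀ i x, ‖f i x‖ ≤ C * w x)
    (hg : ∃ C, ∀ i x, ‖g i x‖ ≤ C * (1 : ℝ)) : ∃ C, ∀ i x, ‖f i x * g i x‖ ≤ C * w x := by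
  obtain ⟨C, hC⟩ := hf
  obtain ⟨D, hD⟩ := hg
  refine ⟨C * D, fun i x => ?_⟩
  rw [norm_mul]
  refine (mul_le_mul (hC i x) (hD i x) (norm_nonneg _)
    ((norm_nonneg _).trans (hC i x))).trans (le_of_eq ?_)
  ring

theorem mul (hf : SymbolBound w n f) (hg : SymbolBound (fun _ => 1) n g) :
    SymbolBound w n (fun i x => f i x * g i x) := by
  induction n generalizing f g with
  | zero => exact ⟨fun i => (hf.1 i).mul (hg.1 i), exists_bound_mul hf.2 hg.2⟩
  | succ n ih =>
    have hf0 := hf.of_succ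
    have hg0 := hg.of_succ
    obtain ⟨hf1, f', hf2, hf3⟩ := hf
    obtain ⟨hg1, g', hg2, hg3⟩ := hg
    exact ⟨exists_bound_mul hf1 hg1, _, fun i x => (hf2 i x).mul (hg2 i x),
      (ih hf3 hg0).add (ih hf0 hg3)⟩

theorem const {c : ι → ℂ} {K : ℝ} (hc : ∀ i, ‖c i‖ ≤ K) (n : ℕ) :
    SymbolBound (fun _ => 1) n (fun i _ => c i) := by
  induction n generalizing c K with
  | zero => exact ⟨fun i => continuous_const, K, fun i x => by simpa using hc i⟩
  | succ n ih =>
    exact ⟨⟨K, fun i x => by simpa using hc i⟩, fun _ _ => 0, fun i x => hasDerivAt_const _ _,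
      ih (c := fun _ => 0) (K := 0) (by simp)⟩

/-- The lower bound 1/2 for |1 + f| bounds the reciprocal, and its derivative is -f' times the
square of the reciprocal, to which the induction hypothesis applies. -/
theorem inv_one_add (hf : SymbolBound (fun _ => 1) n f) (h : ∀ i x, ‖f i x‖ ≤ 1 / 2) :
    SymbolBound (fun _ => 1) n (fun i x => (1 + f i x)⁻¹) := by
  have hlow : ∀ i x, 1 / 2 ≤ ‖1 + f i x‖ := by
    intro i x
    have := norm_sub_norm_le (1 : ℂ) (-f i x)
    rw [norm_one, norm_neg, sub_neg_eq_add] at this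
    linarith [h i x]
  have hne : ∀ i x, 1 + f i x ≠ 0 := by
    intro i x h0
    have := hlow i x
    rw [h0, norm_zero] at this
    linarith
  have hb : ∃ C, ∀ i x, ‖(1 + f i x)⁻¹‖ ≤ C * (1 : ℝ) := by
    refine ⟨2, fun i x => ?_⟩
    rw [norm_inv, mul_one, inv_le_comm₀ (by linarith [hlow i x]) two_pos]
    simpa using hlow i x
  induction n with
  | zero =>
    exact ⟨fun i => (continuous_const.add (hf.1 i)).inv₀ (hne i), hb⟩
  | succ n ih =>
    have h0 := ih hf.of_succ
    obtain ⟨-, f', hf2, hf3⟩ := hf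
    refine ⟨hb, fun i x => (f' i x * (-1)) * ((1 + f i x)⁻¹ * (1 + f i x)⁻¹), fun i x => ?_,
      (hf3.mul (const (c := fun _ => -1) (K := 1) (by simp) n)).mul (h0.mul h0)⟩
    refine (((hf2 i x).const_add 1).inv (hne i x)).congr_deriv ?_
    rw [div_eq_mul_inv, sq, mul_inv]
    ring

theorem schwartz (Φ : SchwartzMap ℝ ℂ) (n : ℕ) :
    SymbolBound (fun x => (1 + x ^ 2)⁻¹) n (fun _ : ι => Φ) := by
  have hb : ∀ Ψ : SchwartzMap ℝ ℂ, ∃ C, ∀ x, ‖Ψ x‖ ≤ C * (1 + x ^ 2)⁻¹ := by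
    intro Ψ
    obtain ⟨C, hC⟩ := Ψ.decay 0 0
    obtain ⟨D, hD⟩ := Ψ.decay 2 0
    refine ⟨C + D, fun x => ?_⟩
    rw [← div_eq_mul_inv, le_div_iff₀ (by positivity)]
    have h1 := hC.2 x
    have h2 := hD.2 x
    simp only [norm_iteratedFDeriv_zero, Real.norm_eq_abs, sq_abs, pow_zero, one_mul] at h1 h2
    linarith
  induction n generalizing Φ with
  | zero => exact ⟨fun _ => Φ.continuous, (hb Φ).imp fun C hC _ => hC⟩
  | succ n ih =>
    refine ⟨(hb Φ).imp fun C hC _ => hC, fun _ => SchwartzMap.derivCLM ℂ ℂ Φ, fun _ x => ?_,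
      ih _⟩
    exact Φ.differentiableAt.hasDerivAt

/-- Each derivative brings out a factor k, which is bounded by 1; this is what keeps the bounds
uniform as the frequency scale hγ tends to zero. -/
theorem comp_affine {b : ℝ → ℂ} (hb : ContDiff ℝ (⊤ : ℕ∞) b) (hc : HasCompactSupport b) (x₀ : ℝ)
    {k : ι → ℝ} (hk : ∀ i, |k i| ≤ 1) (n : ℕ) :
    SymbolBound (fun _ => 1) n (fun i x => b (x₀ + k i * x)) := by
  have hbd : ∀ {b : ℝ → ℂ}, ContDiff ℝ (⊤ : ℕ∞) b → HasCompactSupport b →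
      ∃ C, ∀ (i : ι) x, ‖b (x₀ + k i * x)‖ ≤ C * (1 : ℝ) := by
    intro b hb hc
    obtain ⟨C, hC⟩ := hc.exists_bound_of_continuous hb.continuous
    exact ⟨C, fun i x => by simpa using hC _⟩
  induction n generalizing b with
  | zero => exact ⟨fun i => by have := hb.continuous; fun_prop, hbd hb hc⟩
  | succ n ih =>
    have hb' : ContDiff ℝ (⊤ : ℕ∞) (deriv b) := (contDiff_infty_iff_deriv.1 hb).2
    refine ⟨hbd hb hc, fun i x => deriv b (x₀ + k i * x) * (k i : ℂ), fun i x => ?_,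
      (ih hb' hc.deriv).mul (const (c := fun i => (k i : ℂ)) (K := 1) (by simpa using hk) n)⟩
    have h1 : HasDerivAt b (deriv b (x₀ + k i * x)) (x₀ + k i * x) :=
      ((contDiff_infty_iff_deriv.1 hb).1 _).hasDerivAt
    have h2 : HasDerivAt (fun x => x₀ + k i * x) (k i) x := by
      simpa using ((hasDerivAt_id x).const_mul (k i)).const_add x₀
    have := h1.scomp x h2
    rw [Complex.real_smul, mul_comm] at this
    exact this

end SymbolBound

theorem integrable_of_le_weight {w : ℝ → ℝ} (hw : Integrable w) {f : ℝ → ℂ} (hf : Continuous f)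
    {C : ℝ} (h : ∀ x, ‖f x‖ ≤ C * w x) : Integrable f :=
  (hw.const_mul C).mono' hf.aestronglyMeasurable (Filter.Eventually.of_forall h)

/-- The principle of non-stationary phase, uniformly in families. -/
theorem SymbolBound.nonstationary {ι : Type*} {w : ℝ → ℝ} (hw : Integrable w) {n : ℕ}
    {a q : ι → ℝ → ℂ} (ha : SymbolBound w n a) (hq : SymbolBound (fun _ => 1) n q) :
    ∃ C : ℝ, ∀ (i : ι) (Y : ℝ) (θ g : ℝ → ℝ), Y ≠ 0 → (∀ x, HasDerivAt θ (g x) x) →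
      (∀ x, (g x : ℂ) * q i x = Y) →
      ‖∫ x, a i x * Complex.exp (Complex.I * (θ x : ℂ))‖ ≤ C / |Y| ^ n := by
  induction n generalizing a with
  | zero =>
    obtain ⟨C, hC⟩ := ha.bound
    refine ⟨∫ x, C * w x, fun i Y θ g _ _ _ => ?_⟩
    rw [pow_zero, div_one]
    refine norm_integral_le_of_norm_le (hw.const_mul C) (Filter.Eventually.of_forall fun x => ?_)
    rw [norm_mul, norm_exp_I_mul, mul_one]
    exact hC i x
  | succ n ih =>
    -- Since g q = Y, the integrand is (iY)⁻¹ a q times the derivative of exp(iθ). Integration by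
    -- parts gains |Y|⁻¹ and replaces the amplitude by b = (a q)', at the cost of one derivative. As
    -- b does not involve θ or Y, the constant is uniform in them.
    have haq := ha.mul hq
    obtain ⟨C₁, hC₁⟩ := ha.bound
    obtain ⟨⟨C₂, hC₂⟩, b, hb1, hb2⟩ := haq
    obtain ⟨C₃, hC₃⟩ := hb2.bound
    obtain ⟨C, hC⟩ := ih hb2 hq.of_succ
    refine ⟨C, fun i Y θ g hY hθ hg => ?_⟩
    have hv : ∀ x, HasDerivAt (fun x => Complex.exp (Complex.I * (θ x : ℂ)))
        (Complex.exp (Complex.I * (θ x : ℂ)) * (Complex.I * (g x : ℂ))) x := fun x =>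
      (((hθ x).ofReal_comp).const_mul Complex.I).cexp
    have hcont : Continuous fun x => Complex.exp (Complex.I * (θ x : ℂ)) :=
      continuous_iff_continuousAt.2 fun x => (hv x).continuousAt
    have hmul : ∀ (f : ℝ → ℂ) x, ‖f x * Complex.exp (Complex.I * (θ x : ℂ))‖ = ‖f x‖ := by
      intro f x
      rw [norm_mul, norm_exp_I_mul, mul_one]
    have e1 : ∀ x, a i x * q i x *
        (Complex.exp (Complex.I * (θ x : ℂ)) * (Complex.I * (g x : ℂ))) =
        Complex.I * Y * (a i x * Complex.exp (Complex.I * (θ x : ℂ))) := by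
      intro x
      rw [← hg x]; ring
    have i1 : Integrable fun x => a i x * Complex.exp (Complex.I * (θ x : ℂ)) :=
      integrable_of_le_weight hw ((ha.continuous i).mul hcont)
        fun x => (hmul _ x).trans_le (hC₁ i x)
    have i2 : Integrable fun x => b i x * Complex.exp (Complex.I * (θ x : ℂ)) :=
      integrable_of_le_weight hw ((hb2.continuous i).mul hcont)
        fun x => (hmul _ x).trans_le (hC₃ i x)
    have i3 : Integrable fun x => a i x * q i x * Complex.exp (Complex.I * (θ x : ℂ)) :=
      integrable_of_le_weight hw (((ha.continuous i).mul (hq.continuous i)).mul hcont)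
        fun x => (hmul (fun x => a i x * q i x) x).trans_le (hC₂ i x)
    have key := integral_mul_deriv_eq_deriv_mul_of_integrable
      (u := fun x => a i x * q i x) (u' := b i)
      (v := fun x => Complex.exp (Complex.I * (θ x : ℂ)))
      (v' := fun x => Complex.exp (Complex.I * (θ x : ℂ)) * (Complex.I * (g x : ℂ)))
      (fun x _ => hb1 i x) (fun x _ => hv x)
      (by
        have := i1.const_mul (Complex.I * Y)
        refine this.congr (Filter.Eventually.of_forall fun x => ?_)
        exact (e1 x).symm) i2 i3
    simp only [e1] at key
    rw [integral_const_mul] at key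
    have hn := congrArg norm key
    rw [norm_mul, norm_mul, Complex.norm_I, one_mul, norm_neg, Complex.norm_real,
      Real.norm_eq_abs] at hn
    have hYp : 0 < |Y| := abs_pos.2 hY
    have := hC i Y θ g hY hθ hg
    rw [← hn] at this
    rw [pow_succ, ← div_div, le_div_iff₀ hYp, mul_comm]
    exact this

/-- Decay of an oscillating wave packet away from its ray. -/
theorem exists_packet_decay (Φ : SchwartzMap ℝ ℂ) {b : ℝ → ℂ} (hb : ContDiff ℝ (⊤ : ℕ∞) b)
    (hbc : HasCompactSupport b) {ρ μ : ℝ → ℝ} (hρ : ContDiff ℝ (⊤ : ℕ∞) ρ)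
    (hρc : HasCompactSupport ρ) {c K : ℝ} (hμ : ∀ η, HasDerivAt μ (c + ρ η) η)
    (hK : ∀ η, K * |ρ η| ≤ 1 / 2) (η₀ : ℝ) (n : ℕ) :
    ∃ C : ℝ, ∀ κ γ t y : ℝ, 0 < κ → κ ≤ 1 → 0 < γ → y + t * c ≠ 0 → |t| ≤ K * |y + t * c| →
      ‖∫ ζ, Φ ζ * b (η₀ + κ * ζ) * Complex.exp (Complex.I *
        ((γ * (y * ζ + t * (μ (η₀ + κ * ζ) - μ η₀) / κ) : ℝ) : ℂ))‖ ≤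
      C / (γ * |y + t * c|) ^ n := by
  -- With Y = y + tc the derivative of the phase is γY(1 + (t/Y)ρ). The parameters of the family are
  -- κ and t/Y; the latter is bounded by K, and K|ρ| ≤ 1/2 allows the bracket to be inverted.
  let ι := {p : ℝ × ℝ // |p.1| ≤ 1 ∧ |p.2| ≤ K}
  have ha : SymbolBound (fun x => (1 + x ^ 2)⁻¹) n
      (fun (p : ι) ζ => Φ ζ * b (η₀ + p.1.1 * ζ)) :=
    (SymbolBound.schwartz Φ n).mul (SymbolBound.comp_affine hb hbc η₀ (fun p : ι => p.2.1) n)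
  have hρ' : ContDiff ℝ (⊤ : ℕ∞) fun η => (ρ η : ℂ) := Complex.ofRealCLM.contDiff.comp hρ
  have hρc' : HasCompactSupport fun η => (ρ η : ℂ) := hρc.comp_left Complex.ofReal_zero
  have hr : SymbolBound (fun _ => 1) n
      (fun (p : ι) ζ => (p.1.2 : ℂ) * (ρ (η₀ + p.1.1 * ζ) : ℂ)) :=
    (SymbolBound.const (c := fun p : ι => (p.1.2 : ℂ)) (K := K)
      (fun p => by simpa using p.2.2) n).mul
      (SymbolBound.comp_affine hρ' hρc' η₀ (fun p : ι => p.2.1) n)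
  have hr' : ∀ (p : ι) ζ, ‖(p.1.2 : ℂ) * (ρ (η₀ + p.1.1 * ζ) : ℂ)‖ ≤ 1 / 2 := by
    intro p ζ
    rw [norm_mul, Complex.norm_real, Complex.norm_real, Real.norm_eq_abs, Real.norm_eq_abs]
    exact (mul_le_mul_of_nonneg_right p.2.2 (abs_nonneg _)).trans (hK _)
  obtain ⟨C, hC⟩ := ha.nonstationary integrable_inv_one_add_sq (hr.inv_one_add hr')
  refine ⟨C, fun κ γ t y hκ hκ1 hγ hY ht => ?_⟩
  set Y := y + t * c with hYdef
  have hτ : |t / Y| ≤ K := by rwa [abs_div, div_le_iff₀ (abs_pos.2 hY)]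
  have hmain := hC ⟨(κ, t / Y), by rwa [abs_of_pos hκ], hτ⟩ (γ * Y)
    (fun ζ => γ * (y * ζ + t * (μ (η₀ + κ * ζ) - μ η₀) / κ))
    (fun ζ => γ * (y + t * (c + ρ (η₀ + κ * ζ)))) (mul_ne_zero hγ.ne' hY) ?_ ?_
  · rwa [abs_mul, abs_of_pos hγ] at hmain
  · intro ζ
    have h2 : HasDerivAt (fun x => η₀ + κ * x) κ ζ := by
      simpa using ((hasDerivAt_id ζ).const_mul κ).const_add η₀
    have h3 := ((((hμ (η₀ + κ * ζ)).comp ζ h2).sub_const (μ η₀)).const_mul t).div_const κ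
    have h4 := (((hasDerivAt_id ζ).const_mul y).add h3).const_mul γ
    refine h4.congr_deriv ?_
    field_simp
  · intro ζ
    have h1 : (1 : ℂ) + ((t / Y : ℝ) : ℂ) * (ρ (η₀ + κ * ζ) : ℂ) ≠ 0 := by
      intro h0
      have := hr' ⟨(κ, t / Y), by rwa [abs_of_pos hκ], hτ⟩ ζ
      simp only at this
      rw [← add_eq_zero_iff_neg_eq.1 h0, norm_neg, norm_one] at this
      norm_num at this
    have hY' : (Y : ℂ) ≠ 0 := Complex.ofReal_ne_zero.2 hY
    have h2 : ((γ * (y + t * (c + ρ (η₀ + κ * ζ))) : ℝ) : ℂ) =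
        ((γ * Y : ℝ) : ℂ) * (1 + ((t / Y : ℝ) : ℂ) * (ρ (η₀ + κ * ζ) : ℂ)) := by
      rw [← Complex.ofReal_mul, ← Complex.ofReal_one, ← Complex.ofReal_add, ← Complex.ofReal_mul]
      congr 1
      rw [hYdef] at hY ⊢
      field_simp
      ring
    rw [h2, mul_assoc, mul_inv_cancel₀ h1, mul_one]

/-! ### Concentration of wave packets near the ray -/

theorem contDiff_bump_smul {E : Type*} [NormedAddCommGroup E] [NormedSpace ℝ E] {x₀ R : ℝ}
    (χ : ContDiffBump x₀) (hχ : χ.rOut < R)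
    {f : ℝ → E} (hf : ContDiffOn ℝ (⊤ : ℕ∞) f (Metric.ball x₀ R)) :
    ContDiff ℝ (⊤ : ℕ∞) (fun x => χ x • f x) := by
  rw [contDiff_iff_contDiffAt]
  intro x
  by_cases hx : x ∈ Metric.ball x₀ R
  · exact χ.contDiff.contDiffAt.smul (hf.contDiffAt (Metric.isOpen_ball.mem_nhds hx))
  · have h1 : x ∈ (Metric.closedBall x₀ χ.rOut)ᶜ := by
      simp only [Metric.mem_ball, not_lt, Set.mem_compl_iff, Metric.mem_closedBall, not_le] at hx ⊢
      linarith
    have h2 : (fun x => χ x • f x) =ᶠ[nhds x] fun _ => 0 := by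
      filter_upwards [Metric.isClosed_closedBall.isOpen_compl.mem_nhds h1] with y hy
      rw [Set.mem_compl_iff, Metric.mem_closedBall, not_le] at hy
      rw [χ.zero_of_le_dist hy.le, zero_smul]
    exact contDiffAt_const.congr_of_eventuallyEq h2

/-- The derivative of `lam` is replaced by c + χ (lam' - c), with a bump χ around η₀ supported where
lam' differs from c by less than 1/(2K), and then integrated. The result has a derivative close to c
everywhere, as uniform non-stationarity requires, and is the true phase where χ = 1. -/
theorem exists_global_phase {lam : ℝ → ℝ} {η₀ R K : ℝ} (hR : 0 < R) (hK : 0 < K)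
    (hl : ContDiffOn ℝ (⊤ : ℕ∞) lam (Metric.ball η₀ R)) :
    ∃ r, 0 < r ∧ r < R ∧ ∃ ρ μ : ℝ → ℝ, ContDiff ℝ (⊤ : ℕ∞) ρ ∧ HasCompactSupport ρ ∧
      (∀ η, HasDerivAt μ (deriv lam η₀ + ρ η) η) ∧ (∀ η, K * |ρ η| ≤ 1 / 2) ∧
      ∀ η ∈ Metric.ball η₀ r, μ η = lam η := by
  set c := deriv lam η₀
  have hd : ContDiffOn ℝ (⊤ : ℕ∞) (deriv lam) (Metric.ball η₀ R) :=
    hl.deriv_of_isOpen Metric.isOpen_ball (by norm_num)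
  have hd0 : ContinuousAt (deriv lam) η₀ :=
    hd.continuousOn.continuousAt (Metric.ball_mem_nhds η₀ hR)
  obtain ⟨δ, hδ, hδ2⟩ := Metric.continuousAt_iff.1 hd0 (1 / (2 * K)) (by positivity)
  set r := min δ R / 4 with hr
  have hm : 0 < min δ R := lt_min hδ hR
  have hr0 : 0 < r := by positivity
  have hrδ : 2 * r < δ := by have := min_le_left δ R; linarith
  have hrR : 2 * r < R := by have := min_le_right δ R; linarith
  let χ : ContDiffBump η₀ := ⟨r, 2 * r, hr0, by linarith⟩
  let ρ : ℝ → ℝ := fun η => χ η • (deriv lam η - c)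
  have hρ : ContDiff ℝ (⊤ : ℕ∞) ρ := contDiff_bump_smul χ hrR (hd.sub contDiffOn_const)
  refine ⟨r, hr0, by linarith, ρ, fun η => lam η₀ + ((η - η₀) * c + ∫ x in η₀..η, ρ x), hρ,
    χ.hasCompactSupport.smul_right, fun η => ?_, fun η => ?_, fun η hη => ?_⟩
  · have h1 : HasDerivAt (fun η => ∫ x in η₀..η, ρ x) (ρ η) η :=
      intervalIntegral.integral_hasDerivAt_right (hρ.continuous.intervalIntegrable _ _)
        (hρ.continuous.stronglyMeasurableAtFilter _ _) hρ.continuous.continuousAt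
    have h2 := ((((hasDerivAt_id η).sub_const η₀).mul_const c).add h1).const_add (lam η₀)
    exact h2.congr_deriv (by rw [one_mul])
  · by_cases hη : dist η η₀ < 2 * r
    · have h1 := (hδ2 (hη.trans hrδ)).le
      rw [Real.dist_eq] at h1
      have h2 : |ρ η| ≤ 1 / (2 * K) := by
        simp only [ρ, smul_eq_mul, abs_mul]
        refine (mul_le_mul ?_ h1 (abs_nonneg _) zero_le_one).trans (le_of_eq (one_mul _))
        rw [abs_of_nonneg χ.nonneg]
        exact χ.le_one
      refine (mul_le_mul_of_nonneg_left h2 hK.le).trans (le_of_eq ?_)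
      field_simp
    · have : χ η = 0 := χ.zero_of_le_dist (not_lt.1 hη)
      simp only [ρ, this, zero_smul, abs_zero, mul_zero]
      norm_num
  · have hsub : Set.uIcc η₀ η ⊆ Metric.ball η₀ r :=
      (convex_ball η₀ r).ordConnected.uIcc_subset (Metric.mem_ball_self hr0) hη
    have hsub2 : Set.uIcc η₀ η ⊆ Metric.ball η₀ R :=
      hsub.trans (Metric.ball_subset_ball (by linarith))
    have h1 : ∫ x in η₀..η, ρ x = ∫ x in η₀..η, (deriv lam x - c) := by
      refine intervalIntegral.integral_congr fun x hx => ?_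
      have : χ x = 1 := χ.one_of_mem_closedBall (Metric.ball_subset_closedBall (hsub hx))
      simp only [ρ, this, one_smul]
    have hint : IntervalIntegrable (deriv lam) volume η₀ η :=
      (hd.continuousOn.mono hsub2).intervalIntegrable
    have h2 : ∫ x in η₀..η, deriv lam x = lam η - lam η₀ := by
      refine intervalIntegral.integral_deriv_eq_sub (fun x hx => ?_) hint
      exact (hl.contDiffAt (Metric.isOpen_ball.mem_nhds (hsub2 hx))).differentiableAt (by simp)
    simp only
    rw [h1, intervalIntegral.integral_sub hint intervalIntegrable_const, h2,
      intervalIntegral.integral_const, smul_eq_mul]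
    ring

/-- The profile of a wave packet as a function of `η = h ξ`. -/
def packetProfile (Φ : ℝ → ℂ) (xs η₀ h γ η : ℝ) : ℂ :=
  (Real.sqrt (2 * Real.pi / γ) : ℂ) * Φ ((η - η₀) / (h * γ)) *
    Complex.exp (Complex.I * (-(xs * ((η - η₀) / h)) : ℝ))

/-- The time-dependent factor of a wave. -/
def timePhase (lam : ℝ → ℝ) (h t η : ℝ) : ℂ :=
  Complex.exp (Complex.I * (h⁻¹ * lam η * t : ℝ))

theorem integral_affine {F : ℝ → ℂ} (x₀ : ℝ) {k : ℝ} (hk : 0 < k) :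
    ∫ x, F x = (k : ℂ) * ∫ z, F (x₀ + k * z) := by
  have h1 := Measure.integral_comp_mul_left (fun x => F (x₀ + x)) k
  rw [h1, integral_add_left_eq_self F x₀, abs_of_pos (inv_pos.2 hk), Complex.real_smul,
    ← mul_assoc, ← Complex.ofReal_mul, mul_inv_cancel₀ hk.ne', Complex.ofReal_one, one_mul]

/-- Rescaling of the localized part of a wave packet. -/
theorem norm_sdft_packet (Φ : ℝ → ℂ) {b : ℝ → ℂ} {lam μ : ℝ → ℝ} {η₀ r : ℝ}
    (hr : Metric.ball η₀ r ⊆ Set.Ioo (-Real.pi) Real.pi)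
    (hb : ∀ η ∉ Metric.ball η₀ r, b η = 0) (hμ : ∀ η ∈ Metric.ball η₀ r, μ η = lam η)
    (xs t : ℝ) {h γ : ℝ} (hh : 0 < h) (hγ : 0 < γ) (j : ℤ) :
    ‖sdft (fun η => timePhase lam h t η * ((h : ℂ)⁻¹ * packetProfile Φ xs η₀ h γ η) * b η) j‖ =
      Real.sqrt (γ / (2 * Real.pi)) * ‖∫ ζ, Φ ζ * b (η₀ + h * γ * ζ) *
        Complex.exp (Complex.I * ((γ * ((node h j - xs) * ζ +
          t * (μ (η₀ + h * γ * ζ) - μ η₀) / (h * γ)) : ℝ) : ℂ))‖ := by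
  have hκ : 0 < h * γ := mul_pos hh hγ
  set F : ℝ → ℂ := fun η => timePhase lam h t η * ((h : ℂ)⁻¹ * packetProfile Φ xs η₀ h γ η) * b η *
    Complex.exp (Complex.I * (η * j : ℝ)) with hF
  have e1 : ∫ η in (-Real.pi)..Real.pi, F η = ∫ η, F η := by
    rw [intervalIntegral.integral_of_le neg_pi_lt_pi.le]
    refine setIntegral_eq_integral_of_forall_compl_eq_zero fun η hη => ?_
    have : η ∉ Metric.ball η₀ r := fun h' => hη (Set.Ioo_subset_Ioc_self (hr h'))
    simp only [hF, hb η this, mul_zero, zero_mul]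
  -- All factors that do not depend on ζ after η = η₀ + hγζ; the exponential among them has modulus
  -- one.
  set A : ℂ := (h : ℂ)⁻¹ * (Real.sqrt (2 * Real.pi / γ) : ℂ) *
    Complex.exp (Complex.I * ((t * μ η₀ / h + η₀ * j : ℝ) : ℂ)) with hA
  have e2 : ∀ ζ, F (η₀ + h * γ * ζ) = A * (Φ ζ * b (η₀ + h * γ * ζ) *
        Complex.exp (Complex.I * ((γ * ((node h j - xs) * ζ +
          t * (μ (η₀ + h * γ * ζ) - μ η₀) / (h * γ)) : ℝ) : ℂ))) := by
    intro ζ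
    by_cases hζ : η₀ + h * γ * ζ ∈ Metric.ball η₀ r
    · have hz : (η₀ + h * γ * ζ - η₀) / (h * γ) = ζ := by field_simp; ring
      simp only [hF, hA, timePhase, packetProfile, hz, ← hμ _ hζ]
      have hx : Complex.exp (Complex.I * ((h⁻¹ * μ (η₀ + h * γ * ζ) * t : ℝ) : ℂ)) *
          Complex.exp (Complex.I * ((-(xs * ((η₀ + h * γ * ζ - η₀) / h)) : ℝ) : ℂ)) *
          Complex.exp (Complex.I * (((η₀ + h * γ * ζ) * j : ℝ) : ℂ)) =
          Complex.exp (Complex.I * ((t * μ η₀ / h + η₀ * j : ℝ) : ℂ)) *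
          Complex.exp (Complex.I * ((γ * ((node h j - xs) * ζ +
          t * (μ (η₀ + h * γ * ζ) - μ η₀) / (h * γ)) : ℝ) : ℂ)) := by
        rw [← Complex.exp_add, ← Complex.exp_add, ← Complex.exp_add, ← mul_add, ← mul_add,
          ← mul_add, ← Complex.ofReal_add, ← Complex.ofReal_add, ← Complex.ofReal_add]
        congr 3
        simp only [node]
        field_simp
        ring
      linear_combination (h : ℂ)⁻¹ * (Real.sqrt (2 * Real.pi / γ) : ℂ) * Φ ζ *
        b (η₀ + h * γ * ζ) * hx
    · simp only [hF, hb _ hζ, mul_zero, zero_mul]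
  have e3 : sdft (fun η => timePhase lam h t η * ((h : ℂ)⁻¹ * packetProfile Φ xs η₀ h γ η) * b η) j
      = ((2 * Real.pi)⁻¹ : ℝ) * ∫ η in (-Real.pi)..Real.pi, F η := rfl
  rw [e3, e1, integral_affine η₀ hκ]
  simp only [e2]
  rw [integral_const_mul, norm_mul, norm_mul, norm_mul, hA, norm_mul, norm_mul, norm_exp_I_mul,
    ← mul_assoc, ← mul_assoc]
  congr 1
  have hpi := Real.pi_pos
  rw [norm_inv, Complex.norm_real, Complex.norm_real, Complex.norm_real, Complex.norm_real,
    Real.norm_of_nonneg (by positivity), Real.norm_of_nonneg (by positivity),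
    Real.norm_of_nonneg (by positivity), Real.norm_of_nonneg (by positivity)]
  -- The factors (2π)⁻¹, hγ, h⁻¹ and √(2π/γ) multiply to √(γ/2π).
  rw [show γ / (2 * Real.pi) = (γ / (2 * Real.pi)) ^ 2 * (2 * Real.pi / γ) by field_simp,
    Real.sqrt_mul (by positivity), Real.sqrt_sq (by positivity)]
  field_simp

/-- The sum of `(1 + |x_j|)⁻²` over the grid. -/
theorem summable_node_weight {h : ℝ} (hh : 0 < h) (h1 : h ≤ 1) :
    Summable (fun j : ℤ => ((1 + |node h j|) ^ 2)⁻¹) ∧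
      ∑' j : ℤ, ((1 + |node h j|) ^ 2)⁻¹ ≤ 4 / h := by
  set f : ℕ → ℝ := fun n => ((1 + (n : ℝ) * h) ^ 2)⁻¹ with hf
  have hf0 : ∀ n, 0 ≤ f n := fun n => by positivity
  -- The term (1 + (n+1)h)⁻² is below the reciprocal of (1 + nh)(1 + (n+1)h), which telescopes with
  -- factor 1/h. The first term 1 is later absorbed by h ≤ 1.
  have hp : ∀ N : ℕ, ∑ n ∈ Finset.range (N + 1), f n ≤ 1 + (1 / h - 1 / (h * (1 + N * h))) := by
    intro N
    induction N with
    | zero => simp [hf]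
    | succ N ih =>
      rw [Finset.sum_range_succ]
      have h2 : f (N + 1) ≤ 1 / (h * (1 + N * h)) - 1 / (h * (1 + ((N + 1 : ℕ) : ℝ) * h)) := by
        have e : 1 / (h * (1 + N * h)) - 1 / (h * (1 + ((N + 1 : ℕ) : ℝ) * h)) =
            ((1 + N * h) * (1 + ((N + 1 : ℕ) : ℝ) * h))⁻¹ := by
          push_cast
          field_simp
          ring
        rw [e, hf]
        have h3 : 1 + (N : ℝ) * h ≤ 1 + ((N + 1 : ℕ) : ℝ) * h := by push_cast; nlinarith
        refine inv_anti₀ (by positivity) ?_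
        rw [sq]
        exact mul_le_mul_of_nonneg_right h3 (by positivity)
      linarith
  have hp' : ∀ N : ℕ, ∑ n ∈ Finset.range N, f n ≤ 2 / h := by
    intro N
    have h2 := hp N
    rw [Finset.sum_range_succ] at h2
    have h3 : 0 ≤ 1 / (h * (1 + (N : ℝ) * h)) := by positivity
    have h4 : 1 ≤ 1 / h := by rw [le_div_iff₀ hh]; linarith
    have h5 : 2 / h = 1 / h + 1 / h := by ring
    linarith [hf0 N]
  have hs : Summable f := summable_of_sum_range_le hf0 hp'
  have hs1 : Summable fun n => f (n + 1) := (summable_nat_add_iff 1).2 hs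
  have e1 : (fun n : ℕ => ((1 + |node h n|) ^ 2)⁻¹) = f := by
    funext n
    have : 0 ≤ node h n := by simp only [node]; positivity
    rw [abs_of_nonneg this]
    simp [node, hf]
  have e2 : (fun n : ℕ => ((1 + |node h (-((n : ℤ) + 1))|) ^ 2)⁻¹) = fun n => f (n + 1) := by
    funext n
    have e : node h (-((n : ℤ) + 1)) = -((n + 1 : ℕ) * h) := by simp [node]; ring
    rw [e, abs_neg, abs_of_nonneg (by positivity)]
  have key := HasSum.of_nat_of_neg_add_one (f := fun j : ℤ => ((1 + |node h j|) ^ 2)⁻¹)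
    (by rw [e1]; exact hs.hasSum) (by rw [e2]; exact hs1.hasSum)
  refine ⟨key.summable, ?_⟩
  rw [key.tsum_eq]
  have t1 : ∑' n, f n ≤ 2 / h := Real.tsum_le_of_sum_range_le hf0 hp'
  have t2 : ∑' n, f (n + 1) ≤ 2 / h := by
    have := hs.tsum_eq_zero_add
    linarith [hf0 0]
  have : 4 / h = 2 / h + 2 / h := by ring
  linarith

/-- The mass of `|Φ|²` outside `(-R, R)`. -/
def tailMass (Φ : ℝ → ℂ) (R : ℝ) : ℝ := ∫ ζ, {ζ : ℝ | R ≤ |ζ|}.indicator (fun ζ => ‖Φ ζ‖ ^ 2) ζ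

theorem tailMass_nonneg (Φ : ℝ → ℂ) (R : ℝ) : 0 ≤ tailMass Φ R :=
  integral_nonneg fun _ => Set.indicator_nonneg (fun _ _ => sq_nonneg _) _

theorem memLp_of_continuous {f : ℝ → ℂ} (hf : Continuous f) : MemLp f 2 torusMeasure := by
  obtain ⟨K, -, hK⟩ := exists_bound_of_continuous hf.norm
  exact MemLp.of_bound hf.aestronglyMeasurable K
    (ae_torus fun η hη => (le_abs_self _).trans (hK η hη))

theorem continuous_packetProfile {Φ : ℝ → ℂ} (hΦ : Continuous Φ) (xs η₀ h γ : ℝ) :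
    Continuous (packetProfile Φ xs η₀ h γ) := by
  unfold packetProfile
  fun_prop

theorem continuous_timePhase {lam : ℝ → ℝ} (hl : Continuous lam) (h t : ℝ) :
    Continuous (timePhase lam h t) := by
  unfold timePhase
  fun_prop

theorem norm_sq_packetProfile (Φ : ℝ → ℂ) (xs η₀ h : ℝ) {γ : ℝ} (hγ : 0 < γ) (η : ℝ) :
    ‖packetProfile Φ xs η₀ h γ η‖ ^ 2 = 2 * Real.pi / γ * ‖Φ ((η - η₀) / (h * γ))‖ ^ 2 := by
  have : 0 ≤ 2 * Real.pi / γ := by have := Real.pi_pos; positivity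
  rw [packetProfile, norm_mul, norm_mul, norm_exp_I_mul, mul_one, mul_pow, Complex.norm_real,
    Real.norm_eq_abs, sq_abs, Real.sq_sqrt this]

theorem norm_timePhase (lam : ℝ → ℝ) (h t η : ℝ) : ‖timePhase lam h t η‖ = 1 := norm_exp_I_mul _

theorem sqNorm_add_le (u v : GridFun) (j : ℤ) :
    sqNorm (u + v) j ≤ 2 * (sqNorm u j + sqNorm v j) := by
  have h : ∀ a b : ℂ, ‖a + b‖ ^ 2 ≤ 2 * (‖a‖ ^ 2 + ‖b‖ ^ 2) := by
    intro a b
    refine (pow_le_pow_left₀ (norm_nonneg _) (norm_add_le a b) 2).trans ?_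
    nlinarith [sq_nonneg (‖a‖ - ‖b‖)]
  simp only [sqNorm, Pi.add_apply]
  linarith [h (u j 0) (v j 0), h (u j 1) (v j 1)]

theorem integrable_sq_schwartz (Φ : SchwartzMap ℝ ℂ) : Integrable fun ζ => ‖Φ ζ‖ ^ 2 :=
  (memLp_two_iff_integrable_sq_norm Φ.continuous.aestronglyMeasurable).1 (Φ.memLp 2 volume)

theorem integral_rescale {G : ℝ → ℝ} (x₀ : ℝ) {k : ℝ} (hk : 0 < k) :
    ∫ x, G ((x - x₀) / k) = k * ∫ z, G z := by
  rw [integral_sub_right_eq_self (fun x => G (x / k)) x₀, Measure.integral_comp_div,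
    abs_of_pos hk, smul_eq_mul]

/-- The part of a wave packet at frequencies away from `η₀`. -/
theorem tsum_tail_le (Φ : SchwartzMap ℝ ℂ) {lam : ℝ → ℝ} {η₀ r : ℝ}
    {q : ℝ → Fin 2 → ℂ} {B : ℝ} (hq : ∀ η ∈ Set.Ioo (-Real.pi) Real.pi, ‖q η‖ ≤ B)
    (hq0 : ∀ η, |η - η₀| < r → q η = 0) (xs t : ℝ) {h γ : ℝ} (hh : 0 < h) (hγ : 0 < γ)
    (hm : ∀ c, MemLp (fun η => ((timePhase lam h t η *
        ((h : ℂ)⁻¹ * packetProfile Φ xs η₀ h γ η)) • q η) c) 2 torusMeasure) :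
    ∑' j, sqNorm (sdftVec fun η => (timePhase lam h t η *
        ((h : ℂ)⁻¹ * packetProfile Φ xs η₀ h γ η)) • q η) j ≤
      2 * B ^ 2 / h * tailMass Φ (r / (h * γ)) := by
  have hκ : 0 < h * γ := mul_pos hh hγ
  have hpi := Real.pi_pos
  rw [(hasSum_sqNorm_sdftVec hm).tsum_eq]
  set G : ℝ → ℝ := {ζ : ℝ | r / (h * γ) ≤ |ζ|}.indicator (fun ζ => ‖Φ ζ‖ ^ 2) with hG
  have hGn : ∀ ζ, 0 ≤ G ζ := fun _ => Set.indicator_nonneg (fun _ _ => sq_nonneg _) _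
  have hGi : Integrable G := (integrable_sq_schwartz Φ).indicator
    (measurableSet_le measurable_const measurable_id.abs)
  -- Squared size of the packet times the bound 2B² for the two components. With (2π)⁻¹ from
  -- Parseval and hγ from rescaling it gives 2B²/h.
  set D : ℝ := (h ^ 2)⁻¹ * (2 * Real.pi / γ) * (2 * B ^ 2) with hD
  have hD0 : 0 ≤ D := by positivity
  have hi : Integrable fun η => D * G ((η - η₀) / (h * γ)) :=
    ((hGi.comp_div hκ.ne').comp_sub_right η₀).const_mul D
  have hle : ∫ η in (-Real.pi)..Real.pi, (‖((timePhase lam h t η *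
        ((h : ℂ)⁻¹ * packetProfile Φ xs η₀ h γ η)) • q η) 0‖ ^ 2 + ‖((timePhase lam h t η *
        ((h : ℂ)⁻¹ * packetProfile Φ xs η₀ h γ η)) • q η) 1‖ ^ 2) ≤
      ∫ η, D * G ((η - η₀) / (h * γ)) := by
    rw [intervalIntegral.integral_of_le neg_pi_lt_pi.le]
    refine le_trans ?_ (setIntegral_le_integral (s := Set.Ioc (-Real.pi) Real.pi) hi
      (Filter.Eventually.of_forall fun η => mul_nonneg hD0 (hGn _)))
    refine integral_mono_ae (((memLp_two_iff_integrable_sq_norm (hm 0).1).1 (hm 0)).add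
      ((memLp_two_iff_integrable_sq_norm (hm 1).1).1 (hm 1))) hi.integrableOn
      (ae_torus fun η hη => ?_)
    have hc : ∀ c, ‖((timePhase lam h t η *
        ((h : ℂ)⁻¹ * packetProfile Φ xs η₀ h γ η)) • q η) c‖ ^ 2 =
        (h ^ 2)⁻¹ * (2 * Real.pi / γ) * ‖Φ ((η - η₀) / (h * γ))‖ ^ 2 * ‖q η c‖ ^ 2 := by
      intro c
      rw [Pi.smul_apply, smul_eq_mul, norm_mul, norm_mul, norm_mul, norm_timePhase, one_mul,
        mul_pow, mul_pow, norm_sq_packetProfile _ _ _ _ hγ, norm_inv, Complex.norm_real,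
        Real.norm_of_nonneg hh.le, inv_pow]
      ring
    simp only [hc]
    by_cases hη' : |η - η₀| < r
    · simp only [hq0 η hη', Pi.zero_apply, norm_zero]
      simpa using mul_nonneg hD0 (hGn _)
    · have hmem : (η - η₀) / (h * γ) ∈ {ζ : ℝ | r / (h * γ) ≤ |ζ|} := by
        simp only [Set.mem_ofPred_eq, abs_div, abs_of_pos hκ]
        exact div_le_div_of_nonneg_right (not_lt.1 hη') hκ.le
      rw [hG, Set.indicator_of_mem hmem, hD, ← mul_add]
      have hB : ∀ c, ‖q η c‖ ^ 2 ≤ B ^ 2 := fun c =>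
        pow_le_pow_left₀ (norm_nonneg _) ((norm_le_pi_norm _ c).trans (hq η hη)) 2
      have h2 : ‖q η 0‖ ^ 2 + ‖q η 1‖ ^ 2 ≤ 2 * B ^ 2 := by linarith [hB 0, hB 1]
      refine (mul_le_mul_of_nonneg_left h2 (by positivity)).trans (le_of_eq (by ring))
  refine (mul_le_mul_of_nonneg_left hle (by positivity)).trans (le_of_eq ?_)
  rw [integral_const_mul, integral_rescale η₀ hκ, hD,
    show tailMass Φ (r / (h * γ)) = ∫ ζ, G ζ from rfl]
  field_simp

/-- Wave packets are concentrated near their ray. -/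
theorem exists_localization (Φ : SchwartzMap ℝ ℂ) {lam : ℝ → ℝ} (hlam : Continuous lam)
    {η₀ R r : ℝ} (hr0 : 0 < r) (hrR : r < R)
    (hRI : Metric.ball η₀ R ⊆ Set.Ioo (-Real.pi) Real.pi)
    {p : ℝ → Fin 2 → ℂ} (hp : ContinuousOn p (Set.Ioo (-Real.pi) Real.pi))
    (hps : ContDiffOn ℝ (⊤ : ℕ∞) p (Metric.ball η₀ R)) {B : ℝ}
    (hB : ∀ η ∈ Set.Ioo (-Real.pi) Real.pi, ‖p η‖ ≤ B) {ρ μ : ℝ → ℝ}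
    (hρ : ContDiff ℝ (⊤ : ℕ∞) ρ) (hρc : HasCompactSupport ρ) {c d T xs : ℝ}
    (hμ : ∀ η, HasDerivAt μ (c + ρ η) η) (hK : ∀ η, T / (2 * d) * |ρ η| ≤ 1 / 2)
    (hμl : ∀ η ∈ Metric.ball η₀ r, μ η = lam η) (hd : 0 < d)
    (hray : ∀ t ∈ Set.Icc (0 : ℝ) T, |xs - t * c| ≤ 1 - 3 * d) {n : ℕ} (hn : 1 ≤ n) :
    ∃ C : ℝ, 0 ≤ C ∧ ∀ h γ t : ℝ, 0 < h → h ≤ d → 0 < γ → h * γ ≤ 1 → t ∈ Set.Icc (0 : ℝ) T →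
      ∑' j, {j : ℤ | 1 - h ≤ |node h j|}.indicator (sqNorm (sdftVec fun η =>
        (timePhase lam h t η * ((h : ℂ)⁻¹ * packetProfile Φ xs η₀ h γ η)) • p η)) j ≤
      C / h * (γ / γ ^ (2 * n) + tailMass Φ (r / 2 / (h * γ))) := by
  -- The part under χ lives where the modified phase equals the true one, so non-stationary phase
  -- applies to it. The rest vanishes for |η - η₀| < r/2 and is a tail.
  let χ : ContDiffBump η₀ := ⟨r / 2, r, by linarith, by linarith⟩
  have hb : ∀ c, ContDiff ℝ (⊤ : ℕ∞) fun η => χ η • p η c := fun c =>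
    contDiff_bump_smul χ hrR (contDiffOn_pi.1 hps c)
  have hbc : ∀ c, HasCompactSupport fun η => χ η • p η c := fun c =>
    χ.hasCompactSupport.smul_right
  choose C hC using fun c => exists_packet_decay Φ (hb c) (hbc c) hρ hρc hμ hK η₀ n
  set C' := |C 0| + |C 1| with hC'
  have hC'0 : 0 ≤ C' := by positivity
  have hCle : ∀ c, C c ≤ C' := by
    have h0 := abs_nonneg (C 0)
    have h1 := abs_nonneg (C 1)
    exact Fin.forall_fin_two.2 ⟨(le_abs_self _).trans (by linarith),
      (le_abs_self _).trans (by linarith)⟩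
  have hB0 : 0 ≤ B := (norm_nonneg _).trans (hB η₀ (hRI (Metric.mem_ball_self (by linarith))))
  set M := 2 * C' ^ 2 / d ^ (2 * n) with hM
  have hM0 : 0 ≤ M := by positivity
  refine ⟨2 * (M * 4 + 2 * B ^ 2), by positivity, fun h γ t hh hhd hγ hκ1 ht => ?_⟩
  have hκ : 0 < h * γ := mul_pos hh hγ
  have hd1 : d ≤ 1 / 3 := by
    have := (abs_nonneg _).trans (hray t ht)
    linarith
  set g : ℝ → ℂ := fun η => timePhase lam h t η * ((h : ℂ)⁻¹ * packetProfile Φ xs η₀ h γ η)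
    with hg
  have hgL : MemLp g 2 torusMeasure := memLp_of_continuous
    ((continuous_timePhase hlam h t).mul
      (continuous_const.mul (continuous_packetProfile Φ.continuous xs η₀ h γ)))
  have hχc : Continuous χ := χ.contDiff.continuous (n := 0)
  have hB1 : ∀ η ∈ Set.Ioo (-Real.pi) Real.pi, ‖χ η • p η‖ ≤ B := fun η hη => by
    rw [norm_smul, Real.norm_of_nonneg χ.nonneg]
    exact (mul_le_of_le_one_left (norm_nonneg _) χ.le_one).trans (hB η hη)
  have hB2 : ∀ η ∈ Set.Ioo (-Real.pi) Real.pi, ‖(1 - χ η) • p η‖ ≤ B := fun η hη => by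
    rw [norm_smul, Real.norm_of_nonneg (sub_nonneg.2 χ.le_one)]
    exact (mul_le_of_le_one_left (norm_nonneg _) (by linarith [χ.nonneg (x := η)])).trans (hB η hη)
  have hm1 := memLp_smul_field (p := fun η => χ η • p η) (hχc.continuousOn.smul hp) hB1 hgL
  have hm2 := memLp_smul_field (p := fun η => (1 - χ η) • p η) ((continuous_const.sub hχc).continuousOn.smul hp) hB2 hgL
  set u₁ : GridFun := sdftVec fun η => g η • (χ η • p η) with hu₁
  set u₂ : GridFun := sdftVec fun η => g η • ((1 - χ η) • p η) with hu₂
  have hsplit : (sdftVec fun η => g η • p η) = u₁ + u₂ := by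
    funext j c
    have := sdft_add (hm1 c) (hm2 c) j
    refine Eq.trans ?_ this
    simp only [sdftVec]
    congr 1
    funext η
    simp only [Pi.smul_apply, smul_eq_mul, Complex.real_smul]
    push_cast
    ring
  have hs1 : Summable (sqNorm u₁) := (hasSum_sqNorm_sdftVec hm1).summable
  have hs2 : Summable (sqNorm u₂) := (hasSum_sqNorm_sdftVec hm2).summable
  have htail : ∑' j, sqNorm u₂ j ≤ 2 * B ^ 2 / h * tailMass Φ (r / 2 / (h * γ)) := by
    refine tsum_tail_le Φ hB2 (fun η hη => ?_) xs t hh hγ hm2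
    have : χ η = 1 := χ.one_of_mem_closedBall (by
      rw [Metric.mem_closedBall, Real.dist_eq]; exact hη.le)
    rw [this, sub_self, zero_smul]
  set S' : Set ℤ := {j : ℤ | 1 - h ≤ |node h j|} with hS'
  have hmain : ∀ j ∈ S', sqNorm u₁ j ≤ M * (γ / γ ^ (2 * n)) * ((1 + |node h j|) ^ 2)⁻¹ := by
    intro j hj
    rw [hS', Set.mem_ofPred_eq] at hj
    set Y := node h j - xs + t * c with hY
    have hYl : |node h j| - (1 - 3 * d) ≤ |Y| := by
      have h1 := abs_sub_abs_le_abs_sub (node h j) (xs - t * c)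
      have h2 : node h j - (xs - t * c) = Y := by rw [hY]; ring
      rw [h2] at h1
      linarith [hray t ht]
    -- |Y| is the distance to the ray: the ray stays within 1 - 3d, and |x_j| ≥ 1 - h ≥ 1 - d.
    have hY2 : 2 * d ≤ |Y| := by linarith
    have hYd : d * (1 + |node h j|) ≤ |Y| := by nlinarith
    have hYne : Y ≠ 0 := abs_pos.1 (by linarith)
    -- This explains the constant T/(2d) in the smallness condition on ρ.
    have htK : |t| ≤ T / (2 * d) * |Y| := by
      rw [abs_of_nonneg ht.1, div_mul_eq_mul_div, le_div_iff₀ (by positivity)]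
      have := ht.2
      have := ht.1
      nlinarith
    have hcomp : ∀ c', ‖u₁ j c'‖ ^ 2 ≤ γ * (C' ^ 2 / (γ * |Y|) ^ (2 * n)) := by
      intro c'
      have h1 := norm_sdft_packet Φ (b := fun η => χ η • p η c') (lam := lam) (μ := μ)
        ((Metric.ball_subset_ball hrR.le).trans hRI) (fun η hη => by
          have : χ η = 0 := χ.zero_of_le_dist (by simpa [Metric.mem_ball] using hη)
          rw [this, zero_smul]) hμl xs t hh hγ j
      have h2 := (hC c' (h * γ) γ t (node h j - xs) hκ hκ1 hγ hYne htK).trans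
        (div_le_div_of_nonneg_right (hCle c') (by positivity))
      have h3 : ‖u₁ j c'‖ ≤ Real.sqrt γ * (C' / (γ * |Y|) ^ n) := by
        refine h1.le.trans (mul_le_mul (Real.sqrt_le_sqrt ?_) h2 (norm_nonneg _)
          (Real.sqrt_nonneg _))
        exact div_le_self hγ.le (by linarith [Real.pi_gt_three])
      refine (pow_le_pow_left₀ (norm_nonneg _) h3 2).trans (le_of_eq ?_)
      rw [mul_pow, Real.sq_sqrt hγ.le, div_pow, ← pow_mul, mul_comm n 2]
    -- Since n ≥ 1, the decay in Y contains the summable weight (1 + |x_j|)⁻².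
    have hpow : d ^ (2 * n) * (1 + |node h j|) ^ 2 ≤ |Y| ^ (2 * n) := by
      have h1 : (1 + |node h j|) ^ 2 ≤ (1 + |node h j|) ^ (2 * n) :=
        pow_le_pow_right₀ (by linarith [abs_nonneg (node h j)]) (by omega)
      refine (mul_le_mul_of_nonneg_left h1 (by positivity)).trans ?_
      rw [← mul_pow]
      exact pow_le_pow_left₀ (by positivity) hYd _
    have h4 : sqNorm u₁ j ≤ 2 * (γ * (C' ^ 2 / (γ * |Y|) ^ (2 * n))) := by
      simp only [sqNorm]
      linarith [hcomp 0, hcomp 1]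
    refine h4.trans ?_
    have e : M * (γ / γ ^ (2 * n)) * ((1 + |node h j|) ^ 2)⁻¹ =
        2 * (γ * (C' ^ 2 / (γ ^ (2 * n) * (d ^ (2 * n) * (1 + |node h j|) ^ 2)))) := by
      rw [hM]
      have : (1 + |node h j|) ≠ 0 := by positivity
      field_simp
    rw [e, mul_pow]
    gcongr
  have hw := summable_node_weight hh (by linarith : h ≤ 1)
  have hbound : ∀ j, S'.indicator (sqNorm (u₁ + u₂)) j ≤
      2 * (M * (γ / γ ^ (2 * n)) * ((1 + |node h j|) ^ 2)⁻¹ + sqNorm u₂ j) := by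
    intro j
    by_cases hj : j ∈ S'
    · rw [Set.indicator_of_mem hj]
      exact (sqNorm_add_le _ _ j).trans (by linarith [hmain j hj])
    · rw [Set.indicator_of_notMem hj]
      have := sqNorm_nonneg u₂ j
      positivity
  have hsum := ((hw.1.mul_left (M * (γ / γ ^ (2 * n)))).add hs2).mul_left 2
  have hsu : Summable (sqNorm (u₁ + u₂)) :=
    Summable.of_nonneg_of_le (sqNorm_nonneg _) (sqNorm_add_le u₁ u₂) ((hs1.add hs2).mul_left 2)
  rw [hsplit]
  refine ((hsu.indicator S').tsum_le_tsum hbound hsum).trans ?_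
  rw [tsum_mul_left, (hw.1.mul_left _).tsum_add hs2, tsum_mul_left]
  have ht0 := tailMass_nonneg Φ (r / 2 / (h * γ))
  have h5 := mul_le_mul_of_nonneg_left hw.2
    (by positivity : 0 ≤ M * (γ / γ ^ (2 * n)))
  have e : 2 * (M * 4 + 2 * B ^ 2) / h * (γ / γ ^ (2 * n) + tailMass Φ (r / 2 / (h * γ))) =
      2 * (M * (γ / γ ^ (2 * n)) * (4 / h) + 2 * B ^ 2 / h * tailMass Φ (r / 2 / (h * γ))) +
      (2 * (2 * B ^ 2) / h * (γ / γ ^ (2 * n)) +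
        2 * (M * 4) / h * tailMass Φ (r / 2 / (h * γ))) := by ring
  rw [e]
  have h6 : 0 ≤ 2 * (2 * B ^ 2) / h * (γ / γ ^ (2 * n)) +
        2 * (M * 4) / h * tailMass Φ (r / 2 / (h * γ)) := by positivity
  linarith

/-! ### The packets of the statement and their jumps -/

/-- The position of the solution starting from a wave packet. -/
def packetWave (lam : ℝ → ℝ) (P : ℝ → Fin 2 → ℂ) (Φ : ℝ → ℂ) (xs η₀ h γ t : ℝ) : GridFun :=
  sdftVec fun η => (timePhase lam h t η * ((h : ℂ)⁻¹ * packetProfile Φ xs η₀ h γ η)) • P η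

/-- The velocity of the solution starting from a wave packet. -/
def packetWaveVelocity (lam : ℝ → ℝ) (P : ℝ → Fin 2 → ℂ) (Φ : ℝ → ℂ) (xs η₀ h γ t : ℝ) : GridFun :=
  sdftVec fun η => (timePhase lam h t η * (Complex.I * (h⁻¹ * lam η : ℝ) *
    ((h : ℂ)⁻¹ * packetProfile Φ xs η₀ h γ η))) • P η

/-- The velocity is i/h times a position packet with the field λP in place of P, so one localization
estimate serves for both. -/
theorem packetWaveVelocity_eq (lam : ℝ → ℝ) (P : ℝ → Fin 2 → ℂ) (Φ : ℝ → ℂ)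
    (xs η₀ h γ t : ℝ) : packetWaveVelocity lam P Φ xs η₀ h γ t =
      fun j c => Complex.I * (h⁻¹ : ℝ) *
        packetWave lam (fun η => lam η • P η) Φ xs η₀ h γ t j c := by
  funext j c
  simp only [packetWave, packetWaveVelocity, sdftVec]
  rw [← sdft_const_mul]
  congr 1
  funext η
  simp only [Pi.smul_apply, smul_eq_mul, Complex.real_smul]
  push_cast
  ring

theorem inverseSDFT_eq {h : ℝ} (hh : 0 < h) (F : ℝ → Fin 2 → ℂ) :
    inverseSDFT h F = sdftVec fun η => (h : ℂ)⁻¹ • F (η / h) := by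
  funext j c
  have h1 := intervalIntegral.integral_comp_div (a := -Real.pi) (b := Real.pi)
    (fun ξ => F ξ c * Complex.exp (Complex.I * (ξ * node h j : ℝ))) hh.ne'
  have hc : (h : ℂ) ≠ 0 := Complex.ofReal_ne_zero.2 hh.ne'
  have e : ∀ η : ℝ, η / h * node h j = η * j := by
    intro η
    simp only [node]
    field_simp
  simp only [e] at h1
  simp only [inverseSDFT, sdftVec, Pi.smul_apply, smul_eq_mul]
  rw [sdft_const_mul, sdft, h1, Complex.real_smul]
  set J := ∫ ξ in (-Real.pi / h)..(Real.pi / h), F ξ c * Complex.exp (Complex.I * (ξ * node h j : ℝ))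
  clear_value J
  push_cast
  field_simp

theorem profile_eq (φ : SchwartzMap ℝ ℂ) (xs η₀ : ℝ) {h γ : ℝ} (hh : 0 < h) (hγ : 0 < γ) (η : ℝ) :
    profile φ xs η₀ h γ (η / h) = packetProfile (fourierTransform φ) xs η₀ h γ η := by
  simp only [profile, packetProfile]
  have e1 : (η / h - η₀ / h) / γ = (η - η₀) / (h * γ) := by field_simp
  have e2 : -Complex.I * ((xs * (η / h - η₀ / h) : ℝ) : ℂ) =
      Complex.I * ((-(xs * ((η - η₀) / h)) : ℝ) : ℂ) := by
    push_cast
    ring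
  rw [e1, e2]

theorem packetPosition_eq (lam : ℝ → ℝ) (P : ℝ → Fin 2 → ℂ) (φ : SchwartzMap ℝ ℂ)
    (xs η₀ : ℝ) {h γ : ℝ} (hh : 0 < h) (hγ : 0 < γ) :
    packetPosition P φ xs η₀ h γ = packetWave lam P (fourierTransform φ) xs η₀ h γ 0 := by
  rw [packetPosition, inverseSDFT_eq hh, packetWave]
  congr 1
  funext η
  rw [profile_eq φ xs η₀ hh hγ, mul_div_cancel₀ _ hh.ne', smul_smul]
  simp [timePhase]

theorem packetVelocity_eq (m : Mode) (s : ℝ) (P : ℝ → Fin 2 → ℂ) (φ : SchwartzMap ℝ ℂ)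
    (xs η₀ : ℝ) {h γ : ℝ} (hh : 0 < h) (hγ : 0 < γ) :
    packetVelocity m s P φ xs η₀ h γ =
      packetWaveVelocity (dispersion m 1 s) P (fourierTransform φ) xs η₀ h γ 0 := by
  rw [packetVelocity, inverseSDFT_eq hh, packetWaveVelocity]
  congr 1
  funext η
  rw [profile_eq φ xs η₀ hh hγ, dispersion_scaling m hh, mul_div_cancel₀ _ hh.ne', smul_smul]
  simp only [timePhase, mul_zero, Complex.ofReal_zero, Complex.exp_zero, one_mul]
  congr 1
  ring

/-- The Fourier transform of a Schwartz function is a Schwartz function. -/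
theorem exists_schwartz_fourierTransform (φ : SchwartzMap ℝ ℂ) :
    ∃ Φ : SchwartzMap ℝ ℂ, ⇑Φ = fourierTransform φ ∧ (φ ≠ 0 → ∃ ζ, Φ ζ ≠ 0) := by
  have h2 : (2 * Real.pi)⁻¹ ≠ 0 := by have := Real.pi_pos; positivity
  let e : ℝ ≃L[ℝ] ℝ := ContinuousLinearEquiv.smulLeft (Units.mk0 _ h2)
  have he : ∀ x, e x = (2 * Real.pi)⁻¹ * x := fun x => rfl
  -- `FourierTransform.fourier` uses exp(-2πixξ); dilation by (2π)⁻¹ passes to the present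
  -- convention.
  refine ⟨SchwartzMap.compCLMOfContinuousLinearEquiv ℂ e (FourierTransform.fourier φ), ?_, ?_⟩
  · funext ξ
    rw [SchwartzMap.compCLMOfContinuousLinearEquiv_apply, Function.comp_apply, he,
      SchwartzMap.fourier_coe, Real.fourier_eq', fourierTransform]
    congr 1
    funext x
    rw [smul_eq_mul]
    congr 2
    have : (Real.pi : ℂ) ≠ 0 := Complex.ofReal_ne_zero.2 Real.pi_ne_zero
    simp only [RCLike.inner_apply, conj_trivial]
    push_cast
    field_simp
  · intro hφ
    by_contra! hz
    apply hφ
    apply (FourierTransform.fourierCLE ℂ (SchwartzMap ℝ ℂ)).injective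
    rw [map_zero]
    ext x
    have := hz (2 * Real.pi * x)
    rw [SchwartzMap.compCLMOfContinuousLinearEquiv_apply, Function.comp_apply, he,
      ← mul_assoc, inv_mul_cancel₀ (by have := Real.pi_pos; positivity), one_mul] at this
    exact this

theorem tsum_indicator_smul (S : Set ℤ) (a : ℂ) (u : GridFun) :
    ∑' j, S.indicator (sqNorm fun j c => a * u j c) j =
      ‖a‖ ^ 2 * ∑' j, S.indicator (sqNorm u) j := by
  rw [← tsum_mul_left]
  congr 1
  funext j
  by_cases hj : j ∈ S
  · simp only [Set.indicator_of_mem hj, sqNorm, norm_mul]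
    ring
  · simp only [Set.indicator_of_notMem hj, mul_zero]

theorem memLp_packet {lam : ℝ → ℝ} (hl : Continuous lam) (Φ : SchwartzMap ℝ ℂ)
    (xs η₀ h γ t : ℝ) : MemLp (fun η => timePhase lam h t η *
      ((h : ℂ)⁻¹ * packetProfile Φ xs η₀ h γ η)) 2 torusMeasure :=
  memLp_of_continuous ((continuous_timePhase hl h t).mul
      (continuous_const.mul (continuous_packetProfile Φ.continuous xs η₀ h γ)))

theorem summable_packetWave {lam : ℝ → ℝ} (hl : Continuous lam) {p : ℝ → Fin 2 → ℂ}
    (hp : ContinuousOn p (Set.Ioo (-Real.pi) Real.pi)) {B : ℝ}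
    (hB : ∀ η ∈ Set.Ioo (-Real.pi) Real.pi, ‖p η‖ ≤ B) (Φ : SchwartzMap ℝ ℂ)
    (xs η₀ h γ t : ℝ) : Summable (sqNorm (packetWave lam p Φ xs η₀ h γ t)) :=
  (hasSum_sqNorm_sdftVec (memLp_smul_field hp hB (memLp_packet hl Φ xs η₀ h γ t))).summable

theorem summable_smul (a : ℂ) {u : GridFun} (hu : Summable (sqNorm u)) :
    Summable (sqNorm fun j c => a * u j c) := by
  have e : (sqNorm fun j c => a * u j c) = fun j => ‖a‖ ^ 2 * sqNorm u j := by
    funext j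
    simp only [sqNorm, norm_mul]
    ring
  rw [e]
  exact hu.mul_left _

/-- The jumps of a wave packet. -/
theorem le_tsum_jump {lam : ℝ → ℝ} (hl : Continuous lam) {P : ℝ → Fin 2 → ℂ}
    (hP : ContinuousOn P (Set.Ioo (-Real.pi) Real.pi)) {B : ℝ}
    (hB : ∀ η ∈ Set.Ioo (-Real.pi) Real.pi, ‖P η‖ ≤ B) (Φ : SchwartzMap ℝ ℂ) {η₀ R r q : ℝ}
    (hrR : r < R) (hRI : Metric.ball η₀ R ⊆ Set.Ioo (-Real.pi) Real.pi) (hq0 : 0 ≤ q)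
    (hq : ∀ η ∈ Metric.ball η₀ R, q ≤ ‖P η 1‖) (xs t : ℝ) {h γ Z : ℝ} (hh : 0 < h) (hγ : 0 < γ)
    (hZ : 0 ≤ Z) (hZr : h * γ * Z ≤ r) :
    q ^ 2 / h * ∫ ζ in (-Z)..Z, ‖Φ ζ‖ ^ 2 ≤
      ∑' j, ‖packetWave lam P Φ xs η₀ h γ t j 1‖ ^ 2 := by
  have hκ : 0 < h * γ := mul_pos hh hγ
  have hpi := Real.pi_pos
  have hm := memLp_smul_field hP hB (memLp_packet hl Φ xs η₀ h γ t) 1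
  have hs := hasSum_sq_sdft hm
  have hsum : ∑' j, ‖packetWave lam P Φ xs η₀ h γ t j 1‖ ^ 2 = _ := hs.tsum_eq
  rw [hsum]
  -- Parseval's integral is restricted to |ζ| ≤ Z, where the jump component of the eigenvector is at
  -- least q.
  set a := η₀ - h * γ * Z with ha
  set b := η₀ + h * γ * Z with hb
  have hab : a ≤ b := by
    have : 0 ≤ h * γ * Z := by positivity
    linarith
  have hsub : Set.Icc a b ⊆ Metric.ball η₀ R := by
    intro η hη
    rw [Metric.mem_ball, Real.dist_eq, abs_lt]
    constructor <;> linarith [hη.1, hη.2]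
  have ha1 := (hRI (hsub (Set.left_mem_Icc.2 hab))).1
  have hb1 := (hRI (hsub (Set.right_mem_Icc.2 hab))).2
  have hi : IntervalIntegrable (fun η => ‖((timePhase lam h t η *
      ((h : ℂ)⁻¹ * packetProfile Φ xs η₀ h γ η)) • P η) 1‖ ^ 2) volume (-Real.pi) Real.pi :=
    (intervalIntegrable_iff_integrableOn_Ioc_of_le neg_pi_lt_pi.le).2
      ((memLp_two_iff_integrable_sq_norm hm.1).1 hm)
  have h1 := intervalIntegral.integral_mono_interval ha1.le hab hb1.le
    (Filter.Eventually.of_forall fun η => sq_nonneg _) hi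
  have hΦc : Continuous fun η => (h ^ 2)⁻¹ * (2 * Real.pi / γ) * q ^ 2 *
      ‖Φ (η / (h * γ) - η₀ / (h * γ))‖ ^ 2 := by
    have := Φ.continuous
    fun_prop
  have h2 : ∫ η in a..b, (h ^ 2)⁻¹ * (2 * Real.pi / γ) * q ^ 2 *
      ‖Φ (η / (h * γ) - η₀ / (h * γ))‖ ^ 2 ≤
      ∫ η in a..b, ‖((timePhase lam h t η *
      ((h : ℂ)⁻¹ * packetProfile Φ xs η₀ h γ η)) • P η) 1‖ ^ 2 := by
    refine intervalIntegral.integral_mono_on hab (hΦc.intervalIntegrable _ _)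
      (hi.mono_set ?_) fun η hη => ?_
    · rw [Set.uIcc_of_le hab, Set.uIcc_of_le neg_pi_lt_pi.le]
      exact Set.Icc_subset_Icc ha1.le hb1.le
    · have h3 : q ^ 2 ≤ ‖P η 1‖ ^ 2 := pow_le_pow_left₀ hq0 (hq η (hsub hη)) 2
      rw [Pi.smul_apply, smul_eq_mul, norm_mul, norm_mul, norm_mul, norm_timePhase, one_mul,
        mul_pow, mul_pow, norm_sq_packetProfile _ _ _ _ hγ, norm_inv, Complex.norm_real,
        Real.norm_of_nonneg hh.le, inv_pow, ← sub_div]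
      have h4 := mul_le_mul_of_nonneg_left h3
        (by positivity : 0 ≤ (h ^ 2)⁻¹ * (2 * Real.pi / γ) * ‖Φ ((η - η₀) / (h * γ))‖ ^ 2)
      refine le_trans (le_of_eq ?_) (h4.trans (le_of_eq ?_)) <;> ring
  have h3 := h2.trans h1
  rw [intervalIntegral.integral_const_mul,
    intervalIntegral.integral_comp_div_sub (fun ζ => ‖Φ ζ‖ ^ 2) hκ.ne'] at h3
  have e1 : a / (h * γ) - η₀ / (h * γ) = -Z := by rw [ha]; field_simp; ring
  have e2 : b / (h * γ) - η₀ / (h * γ) = Z := by rw [hb]; field_simp; ring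
  rw [e1, e2, smul_eq_mul] at h3
  refine le_trans (le_of_eq ?_) (mul_le_mul_of_nonneg_left h3
    (by positivity : 0 ≤ (2 * Real.pi)⁻¹))
  field_simp

/-! ### Energy bounds for packets and decay of tails -/

/-- Upper bounds of the observed energy and lower bounds of the total energy of wave packets. -/
theorem exists_packet_energy_bounds {m : Mode} (loc : Localization) {s : ℝ} (hs : 1 < s) {T : ℝ}
    (hT : 0 < T) {xs η₀ : ℝ} (hη₀ : η₀ ∈ Set.Ioo (-Real.pi) Real.pi)
    (hη₀' : m = Mode.physical → η₀ ≠ 0)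
    (hray : ∀ t ∈ Set.Icc (0 : ℝ) T, xs - t * deriv (dispersion m 1 s) η₀ ∉ obsRegion)
    {P : ℝ → Fin 2 → ℂ} (hP : IsEigenvectorField m s P) :
    ∃ d r k : ℝ, 0 < d ∧ 0 < r ∧ 0 < k ∧ ∀ Φ : SchwartzMap ℝ ℂ,
      (∀ n : ℕ, 1 ≤ n → ∃ C : ℝ, 0 ≤ C ∧ ∀ h γ t : ℝ, 0 < h → h ≤ d → 0 < γ → h * γ ≤ 1 →
        t ∈ Set.Icc (0 : ℝ) T →
        |obsEnergy loc h s (packetWave (dispersion m 1 s) P Φ xs η₀ h γ t)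
          (packetWaveVelocity (dispersion m 1 s) P Φ xs η₀ h γ t)| ≤
        C / h ^ 2 * (γ / γ ^ (2 * n) + tailMass Φ (r / (h * γ)))) ∧
      ∀ h γ Z : ℝ, 0 < h → 0 < γ → 0 ≤ Z → h * γ * Z ≤ r →
        k / h ^ 2 * ∫ ζ in (-Z)..Z, ‖Φ ζ‖ ^ 2 ≤
          totalEnergy h s (packetWave (dispersion m 1 s) P Φ xs η₀ h γ 0)
            (packetWaveVelocity (dispersion m 1 s) P Φ xs η₀ h γ 0) := by
  set lam := dispersion m 1 s with hlam
  have hl : Continuous lam := continuous_dispersion_one m hs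
  set c := deriv lam η₀ with hc
  have hin : ∀ t ∈ Set.Icc (0 : ℝ) T, |xs - t * c| < 1 := by
    intro t ht
    have := hray t ht
    rw [obsRegion, Set.notMem_compl_iff] at this
    exact abs_lt.2 this
  -- The position on the ray is affine in t, so its modulus is largest at an endpoint of [0, T].
  set D := max |xs| |xs - T * c| with hD
  have hD1 : D < 1 := by
    refine max_lt ?_ (hin T ⟨hT.le, le_rfl⟩)
    simpa using hin 0 ⟨le_rfl, hT.le⟩
  set d := (1 - D) / 3 with hd
  have hd0 : 0 < d := by rw [hd]; linarith
  have hray' : ∀ t ∈ Set.Icc (0 : ℝ) T, |xs - t * c| ≤ 1 - 3 * d := by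
    intro t ht
    have e : 1 - 3 * d = D := by rw [hd]; ring
    rw [e]
    rcases le_total 0 c with h0 | h0
    · rw [hD, max_comm]
      exact abs_le_max_abs_abs (by nlinarith [ht.2]) (by nlinarith [ht.1])
    · exact abs_le_max_abs_abs (by nlinarith [ht.1]) (by nlinarith [ht.2])
  -- Half of the nonzero jump component at η₀; by continuity the jump component stays above it near
  -- η₀.
  set q := ‖P η₀ 1‖ / 2 with hq
  have hq0 : 0 < q := by
    have := norm_pos_iff.2 (hP.jump_ne_zero hs hη₀ hη₀')
    positivity
  have hnh : ∀ᶠ η in nhds η₀, η ∈ Set.Ioo (-Real.pi) Real.pi ∧ (m = Mode.physical → η ≠ 0) ∧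
      q ≤ ‖P η 1‖ := by
    have h1 : ∀ᶠ η in nhds η₀, η ∈ Set.Ioo (-Real.pi) Real.pi := isOpen_Ioo.mem_nhds hη₀
    have h2 : ∀ᶠ η in nhds η₀, m = Mode.physical → η ≠ 0 := by
      by_cases hm : m = Mode.physical
      · exact (eventually_ne_nhds (hη₀' hm)).mono fun η hη _ => hη
      · exact Filter.Eventually.of_forall fun η h => absurd h hm
    have h3 : ContinuousAt (fun η => ‖P η 1‖) η₀ :=
      ((continuousOn_pi.1 hP.smooth.continuousOn 1).continuousAt (isOpen_Ioo.mem_nhds hη₀)).norm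
    have h4 : q < ‖P η₀ 1‖ := by rw [hq]; linarith
    filter_upwards [h1, h2, h3.eventually (lt_mem_nhds h4)] with η a b c using ⟨a, b, c.le⟩
  obtain ⟨R, hR, hRb⟩ := Metric.eventually_nhds_iff_ball.1 hnh
  have hRI : Metric.ball η₀ R ⊆ Set.Ioo (-Real.pi) Real.pi := fun η hη => (hRb η hη).1
  have hls : ContDiffOn ℝ (⊤ : ℕ∞) lam (Metric.ball η₀ R) := fun η hη =>
    (contDiffAt_dispersion_one hs (hRb η hη).1 (hRb η hη).2.1).contDiffWithinAt
  obtain ⟨r, hr0, hrR, ρ, μ, hρ, hρc, hμ, hK, hμl⟩ := exists_global_phase hR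
    (by positivity : 0 < T / (2 * d)) hls
  obtain ⟨B, hB⟩ := hP.bounded
  obtain ⟨L, hL0, hL⟩ := exists_bound_of_continuous hl
  have hPc := hP.smooth.continuousOn
  have hQc : ContinuousOn (fun η => lam η • P η) (Set.Ioo (-Real.pi) Real.pi) :=
    hl.continuousOn.smul hPc
  have hQB : ∀ η ∈ Set.Ioo (-Real.pi) Real.pi, ‖lam η • P η‖ ≤ L * B := fun η hη => by
    rw [norm_smul]
    exact mul_le_mul (hL η hη) (hB η hη) (norm_nonneg _) hL0.le
  -- The radius is halved because the frequency cutoff equals 1 only within r/2. The last constant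
  -- combines (s-1)/(2h) from the energy with q²/h from the jumps.
  refine ⟨d, r / 2, (s - 1) / 2 * q ^ 2, hd0, by positivity,
    mul_pos (by linarith) (by positivity), fun Φ => ⟨fun n hn => ?_, ?_⟩⟩
  · obtain ⟨C₁, hC₁, hb1⟩ := exists_localization Φ hl hr0 hrR hRI hPc (hP.smooth.mono hRI) hB
      hρ hρc hμ hK hμl hd0 hray' hn
    obtain ⟨C₂, hC₂, hb2⟩ := exists_localization Φ hl hr0 hrR hRI hQc
      (hls.smul (hP.smooth.mono hRI)) hQB hρ hρc hμ hK hμl hd0 hray' hn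
    refine ⟨3 * (s + 4) * (C₁ + C₂), ?_, fun h γ t hh hhd hγ hκ ht => ?_⟩
    · have : 0 < s := by linarith
      positivity
    have b1 := hb1 h γ t hh hhd hγ hκ ht
    have b2 := hb2 h γ t hh hhd hγ hκ ht
    have hsu := summable_packetWave hl hPc hB Φ xs η₀ h γ t
    have hsv := summable_smul (Complex.I * (h⁻¹ : ℝ))
      (summable_packetWave hl hQc hQB Φ xs η₀ h γ t)
    rw [packetWaveVelocity_eq]
    -- Neighbours of observed nodes may lie inside (-1, 1), but by at most h; hence the threshold 1
    -- - h.
    have hS : ∀ j ∈ obsIndices h, j - 1 ∈ {j : ℤ | 1 - h ≤ |node h j|} ∧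
        j ∈ {j : ℤ | 1 - h ≤ |node h j|} ∧ j + 1 ∈ {j : ℤ | 1 - h ≤ |node h j|} := by
      intro j hj
      have h1 : 1 ≤ |node h j| := by
        by_contra hlt
        exact hj (abs_lt.1 (not_le.1 hlt))
      have e1 : node h (j - 1) = node h j - h := by simp only [node]; push_cast; ring
      have e2 : node h (j + 1) = node h j + h := by simp only [node]; push_cast; ring
      simp only [Set.mem_ofPred_eq, e1, e2]
      have h2 := abs_sub_abs_le_abs_sub (node h j) h
      have h3 := abs_sub_abs_le_abs_sub (node h j) (-h)
      rw [sub_neg_eq_add, abs_neg] at h3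
      rw [abs_of_pos hh] at h2 h3
      exact ⟨by linarith, by linarith, by linarith⟩
    refine (abs_obsEnergy_le loc hh hs hsu hsv hS).trans ?_
    rw [tsum_indicator_smul, norm_mul, Complex.norm_I, one_mul, Complex.norm_real,
      Real.norm_of_nonneg (by positivity)]
    set A := γ / γ ^ (2 * n) + tailMass Φ (r / 2 / (h * γ)) with hA
    have h1 : h⁻¹ * ∑' j, {j : ℤ | 1 - h ≤ |node h j|}.indicator
        (sqNorm (packetWave lam P Φ xs η₀ h γ t)) j ≤ h⁻¹ * (C₁ / h * A) :=
      mul_le_mul_of_nonneg_left b1 (by positivity)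
    have h2 : h * (h⁻¹ ^ 2 * ∑' j, {j : ℤ | 1 - h ≤ |node h j|}.indicator
        (sqNorm (packetWave lam (fun η => lam η • P η) Φ xs η₀ h γ t)) j) ≤
        h * (h⁻¹ ^ 2 * (C₂ / h * A)) :=
      mul_le_mul_of_nonneg_left (mul_le_mul_of_nonneg_left b2 (by positivity)) hh.le
    refine (mul_le_mul_of_nonneg_left (add_le_add h1 h2) (by linarith)).trans (le_of_eq ?_)
    field_simp
  · intro h γ Z hh hγ hZ hZr
    have h1 := le_tsum_jump hl hPc hB Φ hrR hRI hq0.le (fun η hη => (hRb η hη).2.2) xs 0 hh hγ hZ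
      (hZr.trans (by linarith))
    rw [packetWaveVelocity_eq]
    have h2 := le_totalEnergy hh hs (summable_packetWave hl hPc hB Φ xs η₀ h γ 0)
      (summable_smul (Complex.I * (h⁻¹ : ℝ)) (summable_packetWave hl hQc hQB Φ xs η₀ h γ 0))
    have h3 : 0 ≤ (s - 1) / (2 * h) := div_nonneg (by linarith) (by positivity)
    refine le_trans (le_of_eq ?_) ((mul_le_mul_of_nonneg_left h1 h3).trans h2)
    field_simp

/-- The tails of a Schwartz function decay rapidly. -/
theorem exists_tailMass_le (Φ : SchwartzMap ℝ ℂ) {r : ℝ} (hr : 0 < r) {α : ℝ} :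
    ∃ C : ℝ, 0 ≤ C ∧ ∀ κ : ℝ, 0 < κ → κ ≤ 1 → (1 / κ) ^ α * tailMass Φ (r / κ) ≤ C := by
  obtain ⟨M, hM⟩ := exists_nat_ge α
  obtain ⟨D, hD⟩ := Φ.decay M 0
  have hint : Integrable fun ζ => D / r ^ M * ‖Φ ζ‖ := Φ.integrable.norm.const_mul _
  refine ⟨∫ ζ, D / r ^ M * ‖Φ ζ‖, integral_nonneg fun ζ =>
    mul_nonneg (div_nonneg hD.1.le (by positivity)) (norm_nonneg _), fun κ hκ hκ1 => ?_⟩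
  have h1 : (1 / κ) ^ α ≤ (1 / κ) ^ M := by
    rw [← Real.rpow_natCast]
    exact Real.rpow_le_rpow_of_exponent_le (by rw [le_div_iff₀ hκ]; linarith) hM
  refine (mul_le_mul_of_nonneg_right h1 (tailMass_nonneg _ _)).trans ?_
  rw [tailMass, ← integral_const_mul]
  refine integral_mono_of_nonneg (Filter.Eventually.of_forall fun ζ => ?_) hint
    (Filter.Eventually.of_forall fun ζ => ?_)
  · exact mul_nonneg (by positivity) (Set.indicator_nonneg (fun _ _ => sq_nonneg _) _)
  · simp only
    by_cases hζ : ζ ∈ {ζ : ℝ | r / κ ≤ |ζ|}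
    · rw [Set.indicator_of_mem hζ]
      rw [Set.mem_ofPred_eq, div_le_iff₀ hκ] at hζ
      have h2 := hD.2 ζ
      rw [norm_iteratedFDeriv_zero, Real.norm_eq_abs] at h2
      -- On the tail 1/κ is traded for |ζ|/r. One factor Φ absorbs the resulting power of |ζ|, the
      -- other provides integrability.
      have h3 : 1 / κ ≤ |ζ| / r := by
        rw [div_le_div_iff₀ hκ hr]; linarith
      have h4 : (1 / κ) ^ M ≤ |ζ| ^ M / r ^ M := by
        rw [← div_pow]
        exact pow_le_pow_left₀ (by positivity) h3 M
      calc (1 / κ) ^ M * ‖Φ ζ‖ ^ 2 ≤ |ζ| ^ M / r ^ M * ‖Φ ζ‖ ^ 2 :=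
            mul_le_mul_of_nonneg_right h4 (sq_nonneg _)
        _ = (|ζ| ^ M * ‖Φ ζ‖) / r ^ M * ‖Φ ζ‖ := by ring
        _ ≤ D / r ^ M * ‖Φ ζ‖ := by gcongr
    · rw [Set.indicator_of_notMem hζ, mul_zero]
      exact mul_nonneg (div_nonneg hD.1.le (by positivity)) (norm_nonneg _)

theorem integral_sq_pos (Φ : SchwartzMap ℝ ℂ) {ζ Z : ℝ} (hζ : Φ ζ ≠ 0) (hZ : |ζ| < Z) :
    0 < ∫ z in (-Z)..Z, ‖Φ z‖ ^ 2 := by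
  have hZ' := abs_lt.1 hZ
  have := Φ.continuous
  refine intervalIntegral.integral_pos (by linarith [abs_nonneg ζ]) (by fun_prop)
    (fun _ _ => sq_nonneg _) ⟨ζ, ⟨hZ'.1.le, hZ'.2.le⟩, ?_⟩
  have := norm_pos_iff.2 hζ
  positivity

/-- Chooses the number of integrations by parts: n = M + 1 with M ≥ α turns γ^(1-2n) into γ^(-2M-1).
-/
theorem exists_rpow_mul_le_one (α : ℝ) :
    ∃ n : ℕ, 1 ≤ n ∧ ∀ γ : ℝ, 1 ≤ γ → γ ^ α * (γ / γ ^ (2 * n)) ≤ 1 := by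
  obtain ⟨M, hM⟩ := exists_nat_ge α
  refine ⟨M + 1, by omega, fun γ hγ => ?_⟩
  have h0 : 0 < γ := by linarith
  have h1 : γ ^ α ≤ γ ^ (2 * M + 1) := by
    rw [← Real.rpow_natCast]
    refine Real.rpow_le_rpow_of_exponent_le hγ ?_
    push_cast
    have : (0 : ℝ) ≤ M := Nat.cast_nonneg M
    linarith
  refine (mul_le_mul_of_nonneg_right h1 (by positivity)).trans (le_of_eq ?_)
  rw [show 2 * (M + 1) = 2 * M + 1 + 1 by ring, pow_succ γ (2 * M + 1)]
  field_simp

/-- A Schwartz function supported in the unit interval. -/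
theorem exists_schwartz_bump : ∃ Φ : SchwartzMap ℝ ℂ, Φ 0 ≠ 0 ∧ ∀ ζ, 1 ≤ |ζ| → Φ ζ = 0 := by
  let χ : ContDiffBump (0 : ℝ) := ⟨1 / 2, 1, by norm_num, by norm_num⟩
  have h1 : HasCompactSupport fun x => (χ x : ℂ) := χ.hasCompactSupport.comp_left Complex.ofReal_zero
  have h2 : ContDiff ℝ (⊤ : ℕ∞) fun x => (χ x : ℂ) := Complex.ofRealCLM.contDiff.comp χ.contDiff
  refine ⟨h1.toSchwartzMap h2, ?_, fun ζ hζ => ?_⟩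
  · have : χ 0 = 1 := χ.one_of_mem_closedBall (Metric.mem_closedBall_self (by norm_num [χ]))
    simp [this]
  · have : χ ζ = 0 := χ.zero_of_le_dist (by simpa [χ] using hζ)
    simp [this]

theorem tailMass_eq_zero {Φ : ℝ → ℂ} (h : ∀ ζ, 1 ≤ |ζ| → Φ ζ = 0) {R : ℝ} (hR : 1 ≤ R) :
    tailMass Φ R = 0 := by
  have : ({ζ : ℝ | R ≤ |ζ|}.indicator fun ζ => ‖Φ ζ‖ ^ 2) = fun _ => 0 := by
    funext ζ
    by_cases hζ : ζ ∈ {ζ : ℝ | R ≤ |ζ|}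
    · rw [Set.indicator_of_mem hζ, h ζ (hR.trans hζ), norm_zero, zero_pow two_ne_zero]
    · rw [Set.indicator_of_notMem hζ]
  rw [tailMass, this, MeasureTheory.integral_zero]

theorem exists_packet_solution {m : Mode} {s : ℝ} (hs : 1 < s) {P : ℝ → Fin 2 → ℂ}
    (hP : IsEigenvectorField m s P) (Φ : SchwartzMap ℝ ℂ) (xs η₀ : ℝ) {h : ℝ} (hh : 0 < h) (γ : ℝ) :
    ∃ U V : ℝ → GridState, IsSolution h s U V ∧
      (∀ t, coords (U t) = packetWave (dispersion m 1 s) P Φ xs η₀ h γ t) ∧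
      ∀ t, coords (V t) = packetWaveVelocity (dispersion m 1 s) P Φ xs η₀ h γ t :=
  exists_isSolution hs hP hh (memLp_of_continuous
    (continuous_const.mul (continuous_packetProfile Φ.continuous xs η₀ h γ)))

end SIPG

end

/-! ### Choice of the parameters and conclusion -/

theorem mainTheorem1
    (m : SIPG.Mode) (loc : SIPG.Localization)
    (s : ℝ) (hs : 1 < s) (T : ℝ) (hT : 0 < T)
    (xs η₀ : ℝ) (hη₀ : η₀ ∈ Set.Ioo (-Real.pi) Real.pi)
    (hη₀' : m = SIPG.Mode.physical → η₀ ≠ 0)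
    (hray : ∀ t ∈ Set.Icc (0 : ℝ) T,
      xs - t * deriv (SIPG.dispersion m 1 s) η₀ ∉ SIPG.obsRegion)
    (P : ℝ → Fin 2 → ℂ) (hP : SIPG.IsEigenvectorField m s P)
    (φ : SchwartzMap ℝ ℂ) (hφ : φ ≠ 0) :
    ∃ ε : ℝ, 0 < ε ∧ ∀ α : ℝ, 0 ≤ α → ∃ C : ℝ, 0 < C ∧
      ∀ h γ : ℝ, 0 < h → 1 / ε ≤ γ → h * γ ≤ ε →
        ENNReal.ofReal (C * γ ^ α) ≤ SIPG.obsConstant loc h s T ∧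
        ∃ U V : ℝ → SIPG.GridState,
          SIPG.IsSolution h s U V ∧
          SIPG.coords (U 0) = SIPG.packetPosition P φ xs η₀ h γ ∧
          SIPG.coords (V 0) = SIPG.packetVelocity m s P φ xs η₀ h γ ∧
          0 < SIPG.totalEnergy h s (SIPG.coords (U 0)) (SIPG.coords (V 0)) ∧
          C * (min γ (1 / (h * γ))) ^ α *
              (∫ t in (0 : ℝ)..T,
                |SIPG.obsEnergy loc h s (SIPG.coords (U t)) (SIPG.coords (V t))|) ≤
            SIPG.totalEnergy h s (SIPG.coords (U 0)) (SIPG.coords (V 0)) := by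
  obtain ⟨d, r, k, hd, hr, hk, hbounds⟩ :=
    SIPG.exists_packet_energy_bounds loc hs hT hη₀ hη₀' hray hP
  obtain ⟨Φ, hΦ, hΦ0⟩ := SIPG.exists_schwartz_fourierTransform φ
  obtain ⟨ζ₀, hζ₀⟩ := hΦ0 hφ
  -- Ψ serves as the Fourier profile of a second packet, used only for the observability constant.
  obtain ⟨Ψ, hΨ0, hΨ⟩ := SIPG.exists_schwartz_bump
  set Z := |ζ₀| + 1 with hZ
  have hZ0 : 0 < Z := by positivity
  set I₀ := ∫ ζ in (-Z)..Z, ‖Φ ζ‖ ^ 2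
  have hI₀ : 0 < I₀ := SIPG.integral_sq_pos Φ hζ₀ (by rw [hZ]; linarith)
  set I₁ := ∫ ζ in (-1 : ℝ)..1, ‖Ψ ζ‖ ^ 2
  have hI₁ : 0 < I₁ := SIPG.integral_sq_pos Ψ hΨ0 (by norm_num)
  -- The bounds 1 and d give γ ≥ 1, hγ ≤ 1 and h ≤ d; r removes the tail of Ψ, whose support is in
  -- the unit interval; r/Z keeps the frequencies |ζ| ≤ Z inside the ball where the jumps are
  -- bounded below.
  set ε := min (min 1 d) (min r (r / Z)) with hε
  have hε0 : 0 < ε := lt_min (lt_min one_pos hd) (lt_min hr (by positivity))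
  have hε1 : ε ≤ 1 := (min_le_left _ _).trans (min_le_left _ _)
  have hεd : ε ≤ d := (min_le_left _ _).trans (min_le_right _ _)
  have hεr : ε ≤ r := (min_le_right _ _).trans (min_le_left _ _)
  have hεZ : ε * Z ≤ r := by
    rw [← le_div_iff₀ hZ0]
    exact (min_le_right _ _).trans (min_le_right _ _)
  refine ⟨ε, hε0, fun α hα => ?_⟩
  obtain ⟨n, hn, hn2⟩ := SIPG.exists_rpow_mul_le_one α
  obtain ⟨A, hA, hA2⟩ := (hbounds Φ).1 n hn
  obtain ⟨A', hA', hA2'⟩ := (hbounds Ψ).1 n hn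
  obtain ⟨D, hD, hD2⟩ := SIPG.exists_tailMass_le Φ hr (α := α)
  -- The added 1 keeps the denominators positive, since the constants of the upper bounds may be
  -- zero.
  set C₁ := k * I₁ / (A' * T + 1) with hC₁
  set C₂ := k * I₀ / (A * (1 + D) * T + 1) with hC₂
  have hC₁0 : 0 < C₁ := by positivity
  have hC₂0 : 0 < C₂ := by positivity
  refine ⟨min C₁ C₂, lt_min hC₁0 hC₂0, fun h γ hh hγε hκε => ?_⟩
  have hγ1 : 1 ≤ γ := by
    refine le_trans ?_ hγε
    rw [le_div_iff₀ hε0]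
    linarith
  have hγ : 0 < γ := by linarith
  have hκ : 0 < h * γ := mul_pos hh hγ
  have hκ1 : h * γ ≤ 1 := hκε.trans hε1
  have hhd : h ≤ d := by nlinarith
  have hγα : 0 < γ ^ α := Real.rpow_pos_of_pos hγ _
  have hh2 : 0 < h ^ 2 := by positivity
  have hx := hn2 γ hγ1
  constructor
  -- It suffices to bound every admissible constant from below; if there is none, the infimum is ∞.
  · refine le_sInf ?_
    rintro _ ⟨c, ⟨hc0, hc⟩, rfl⟩
    refine ENNReal.ofReal_le_ofReal ?_
    obtain ⟨U, V, hUV, hU, hV⟩ := SIPG.exists_packet_solution hs hP Ψ xs η₀ hh γ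
    have h1 := hc U V hUV
    have h2 := (hbounds Ψ).2 h γ 1 hh hγ zero_le_one (by linarith)
    rw [hU 0, hV 0] at h1
    have ht0 : SIPG.tailMass Ψ (r / (h * γ)) = 0 :=
      SIPG.tailMass_eq_zero hΨ (by rw [le_div_iff₀ hκ]; linarith)
    -- The observed energy may be negative, so it is bounded in modulus. Integrability in time need
    -- not be known, as the integral is zero by default otherwise.
    have h3 : ‖∫ t in (0 : ℝ)..T, SIPG.obsEnergy loc h s (SIPG.coords (U t)) (SIPG.coords (V t))‖ ≤
        A' / h ^ 2 * (γ / γ ^ (2 * n)) * |T - 0| := by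
      refine intervalIntegral.norm_integral_le_of_norm_le_const fun t ht => ?_
      rw [Set.uIoc_of_le hT.le] at ht
      have := hA2' h γ t hh hhd hγ hκ1 ⟨ht.1.le, ht.2⟩
      rw [ht0, add_zero] at this
      rwa [hU t, hV t]
    rw [sub_zero, abs_of_pos hT] at h3
    have h4 := h2.trans (h1.trans (mul_le_mul_of_nonneg_left ((le_abs_self _).trans h3) hc0))
    have h5 : k * I₁ ≤ c * (A' * T) * (γ / γ ^ (2 * n)) := by
      have := mul_le_mul_of_nonneg_left h4 hh2.le
      have e1 : h ^ 2 * (k / h ^ 2 * I₁) = k * I₁ := by field_simp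
      have e2 : h ^ 2 * (c * (A' / h ^ 2 * (γ / γ ^ (2 * n)) * T)) =
        c * (A' * T) * (γ / γ ^ (2 * n)) := by field_simp
      rwa [e1, e2] at this
    have h6 : k * I₁ * γ ^ α ≤ c * (A' * T) := by
      refine (mul_le_mul_of_nonneg_right h5 hγα.le).trans ?_
      rw [mul_assoc, mul_comm (γ / _)]
      exact mul_le_of_le_one_right (by positivity) hx
    refine (mul_le_mul_of_nonneg_right (min_le_left C₁ C₂) hγα.le).trans ?_
    rw [hC₁, div_mul_eq_mul_div, div_le_iff₀ (by positivity)]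
    linarith
  · obtain ⟨U, V, hUV, hU, hV⟩ := SIPG.exists_packet_solution hs hP Φ xs η₀ hh γ
    have h2 := (hbounds Φ).2 h γ Z hh hγ hZ0.le
      ((mul_le_mul_of_nonneg_right hκε hZ0.le).trans hεZ)
    rw [← hU 0, ← hV 0] at h2
    have hpos : 0 < k / h ^ 2 * I₀ := by positivity
    refine ⟨U, V, hUV, ?_, ?_, hpos.trans_le h2, ?_⟩
    · rw [hU, hΦ, SIPG.packetPosition_eq _ P φ xs η₀ hh hγ]
    · rw [hV, hΦ, SIPG.packetVelocity_eq m s P φ xs η₀ hh hγ]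
    set M := min γ (1 / (h * γ)) with hM
    have hM0 : 0 < M := lt_min hγ (by positivity)
    have hMα : 0 < M ^ α := Real.rpow_pos_of_pos hM0 _
    have hM1 : M ^ α ≤ γ ^ α := Real.rpow_le_rpow hM0.le (min_le_left _ _) hα
    have hM2 : M ^ α ≤ (1 / (h * γ)) ^ α := Real.rpow_le_rpow hM0.le (min_le_right _ _) hα
    set τ := γ / γ ^ (2 * n) + SIPG.tailMass Φ (r / (h * γ)) with hτ
    -- The minimum is used twice: as at most γ against the non-stationary part, and as at most
    -- 1/(hγ) against the tail.
    have hτ1 : M ^ α * τ ≤ 1 + D := by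
      rw [hτ, mul_add]
      exact add_le_add ((mul_le_mul_of_nonneg_right hM1 (by positivity)).trans hx)
        ((mul_le_mul_of_nonneg_right hM2 (SIPG.tailMass_nonneg _ _)).trans (hD2 _ hκ hκ1))
    set J := ∫ t in (0 : ℝ)..T,
      |SIPG.obsEnergy loc h s (SIPG.coords (U t)) (SIPG.coords (V t))| with hJ
    have hJ0 : 0 ≤ J := intervalIntegral.integral_nonneg hT.le fun _ _ => abs_nonneg _
    have h3 : ‖J‖ ≤ A / h ^ 2 * τ * |T - 0| := by
      refine intervalIntegral.norm_integral_le_of_norm_le_const fun t ht => ?_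
      rw [Set.uIoc_of_le hT.le] at ht
      rw [norm_abs_eq_norm, hU t, hV t]
      exact hA2 h γ t hh hhd hγ hκ1 ⟨ht.1.le, ht.2⟩
    rw [sub_zero, abs_of_pos hT, Real.norm_of_nonneg hJ0] at h3
    refine le_trans ?_ h2
    have h4 : M ^ α * J ≤ A * (1 + D) * T / h ^ 2 := by
      refine (mul_le_mul_of_nonneg_left h3 hMα.le).trans ?_
      have e : M ^ α * (A / h ^ 2 * τ * T) = A / h ^ 2 * T * (M ^ α * τ) := by ring
      rw [e]
      refine (mul_le_mul_of_nonneg_left hτ1 (by positivity)).trans (le_of_eq ?_)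
      field_simp
    calc min C₁ C₂ * M ^ α * J ≤ C₂ * (M ^ α * J) := by
          rw [mul_assoc]
          exact mul_le_mul_of_nonneg_right (min_le_right _ _) (by positivity)
      _ ≤ C₂ * (A * (1 + D) * T / h ^ 2) := mul_le_mul_of_nonneg_left h4 hC₂0.le
      _ ≤ C₂ * ((A * (1 + D) * T + 1) / h ^ 2) := by gcongr; linarith
      _ = k / h ^ 2 * I₀ := by rw [hC₂]; field_simp
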